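/- All polytopes are in $\mathbb{R}^2$. A lattice polytope is the convex hull of finitely many points of $\mathbb{Z}^2$. Let $\Delta$ be a lattice polytope that is \emph{nonhyperelliptic} (its interior lattice points are not collinear) and \emph{maximal} (no lattice polytope $\Delta' \supsetneq \Delta$ has the same interior lattice points as $\Delta$). Let $\Delta^{(1)}$ be the convex hull of the interior lattice points of $\Delta$; let $r$ and $r^{(1)}$ be the numbers of lattice points on the boundaries of $\Delta$ and of $\Delta^{(1)}$. Let $c(\Delta)$ be the number of \emph{column vectors} of $\Delta$, i.e. of nonzero $v \in \mathbb{Z}^2$ for which there is a facet (edge) $\tau$ of $\Delta$ with $v + ((\Delta\setminus\tau)\cap\mathbb{Z}^2) \subset \Delta$. A \emph{legal move} is a pair $(v,w)$ of vectors of $\mathbb{Z}^2$ such that $\mathrm{conv}\{0,v,w\}$ is a $2$-dimensional triangle whose only nonzero lattice points lie on the edge between $v$ and $w$; its length is $\ell(v,w)=\det\begin{pmatrix} v\\ w\end{pmatrix}$, which may be negative. A \emph{legal loop} is a cyclic sequence $v_1,\dots,v_m\in\mathbb{Z}^2$ such that every $(v_i,v_{i+1})$ is a legal move and no three cyclically consecutive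 terms $v_{i-1},v_i,v_{i+1}$ lie on a line. For a cyclic sequence $\mathcal{P}=(v_i)$ put $\ell(\mathcal{P})=\sum_i \det\begin{pmatrix} v_i\\ v_{i+1}\end{pmatrix}$, and for a legal loop $\mathcal{P}$ let $\mathcal{P}^\vee=(w_i)$ with $w_i=\ell(v_i,v_{i+1})^{-1}(v_{i+1}-v_i)$ be the dual loop. Let $p_1,\dots,p_n$ be the vertices of $\Delta^{(1)}$ in counterclockwise order. For each $i$, let $p_i^{(-1)}$ be the intersection point of the lines $a_1X+a_2Y=b+1$, where $a_1X+a_2Y\le b$ (with $a_1,a_2\in\mathbb{Z}$ coprime) runs through the inequalities defining the two edges of $\Delta^{(1)}$ that contain $p_i$. Let $q_i=p_i^{(-1)}-p_i$, and let $\mathcal{P}(\Delta)$ be the cyclic sequence $q_1,\dots,q_n$ in which each block of cyclically consecutive equal terms is replaced by a single term. Then $\mathcal{P}(\Delta)$ exists and is a legal loop, and (a) $r - r^{(1)} = \ell(\mathcal{P}(\Delta)) \leq 9$; (b) $r - r^{(1)} - c(\Delta) \leq \min\left(\ell(\mathcal{P}(\Delta)),\ell(\mathcal{P}(\Delta)^\vee)\right)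 \leq 6$. -/

import Mathlib

/-- The inclusion of the lattice `ℤ²` in the plane `ℝ²`. -/
def toPlane (p : ℤ × ℤ) : ℝ × ℝ := ((p.1 : ℝ), (p.2 : ℝ))

/-- The determinant of the matrix with rows `v` and `w`. -/
def det₂ (v w : ℝ × ℝ) : ℝ := v.1 * w.2 - v.2 * w.1

/-- A lattice polytope in the plane: the convex hull of finitely many lattice points. -/
def IsLatticePolytope (Δ : Set (ℝ × ℝ)) : Prop :=
  ∃ S : Finset (ℤ × ℤ), Δ = convexHull ℝ (toPlane '' (S : Set (ℤ × ℤ)))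

/-- The lattice points in the interior of `Δ`. -/
def interiorLatticePoints (Δ : Set (ℝ × ℝ)) : Set (ℤ × ℤ) :=
  {p | toPlane p ∈ interior Δ}

/-- `Δ⁽¹⁾`, the convex hull of the interior lattice points of `Δ`. -/
def interiorPolytope (Δ : Set (ℝ × ℝ)) : Set (ℝ × ℝ) :=
  convexHull ℝ (toPlane '' interiorLatticePoints Δ)

/-- The number of lattice points on the boundary of `Δ`. -/
noncomputable def boundaryCount (Δ : Set (ℝ × ℝ)) : ℕ :=
  {p : ℤ × ℤ | toPlane p ∈ frontier Δ}.ncard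

/-- `Δ` is nonhyperelliptic: its interior lattice points are not collinear. -/
def IsNonhyperelliptic (Δ : Set (ℝ × ℝ)) : Prop :=
  ¬ Collinear ℝ (toPlane '' interiorLatticePoints Δ)

/-- `Δ` is maximal: it is not properly contained in a lattice polytope
with the same interior lattice points. -/
def IsMaximalPolytope (Δ : Set (ℝ × ℝ)) : Prop :=
  ∀ Δ' : Set (ℝ × ℝ), IsLatticePolytope Δ' → Δ ⊂ Δ' →
    interiorLatticePoints Δ' ≠ interiorLatticePoints Δ

/-- The linear form `a₁ X + a₂ Y`. -/
def linForm (a : ℤ × ℤ) (x : ℝ × ℝ) : ℝ := (a.1 : ℝ) * x.1 + (a.2 : ℝ) * x.2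

/-- The inequality `a₁ X + a₂ Y ≤ b`, with `a₁`, `a₂` coprime, defines a facet of the
(two-dimensional) polytope `Δ`: it holds on `Δ`, and it is an equality at two distinct points. -/
def IsFacetInequality (Δ : Set (ℝ × ℝ)) (a : ℤ × ℤ) (b : ℤ) : Prop :=
  IsCoprime a.1 a.2 ∧ (∀ x ∈ Δ, linForm a x ≤ b) ∧ {x ∈ Δ | linForm a x = b}.Nontrivial

/-- `τ` is a facet (an edge) of the two-dimensional lattice polytope `Δ`. -/
def IsFacet (Δ τ : Set (ℝ × ℝ)) : Prop :=
  ∃ (a : ℤ × ℤ) (b : ℤ), IsFacetInequality Δ a b ∧ τ = {x ∈ Δ | linForm a x = b}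

/-- `v` is a column vector of `Δ`, for some base facet `τ`. -/
def IsColumnVector (Δ : Set (ℝ × ℝ)) (v : ℤ × ℤ) : Prop :=
  v ≠ 0 ∧ ∃ τ, IsFacet Δ τ ∧ ∀ p : ℤ × ℤ, toPlane p ∈ Δ \ τ → toPlane (v + p) ∈ Δ

/-- `c(Δ)`, the number of column vectors of `Δ`. -/
noncomputable def columnCount (Δ : Set (ℝ × ℝ)) : ℕ :=
  {v : ℤ × ℤ | IsColumnVector Δ v}.ncard

/-- `(v, w)` is a legal move: `v` and `w` are lattice vectors, and `conv {0, v, w}` is a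
two-dimensional triangle whose only nonzero lattice points lie on the edge from `v` to `w`. -/
def IsLegalMove (v w : ℝ × ℝ) : Prop :=
  v ∈ Set.range toPlane ∧ w ∈ Set.range toPlane ∧
  ¬ Collinear ℝ {0, v, w} ∧
  ∀ p : ℤ × ℤ, p ≠ 0 → toPlane p ∈ convexHull ℝ {0, v, w} → toPlane p ∈ segment ℝ v w

/-- A legal loop. The index that follows `i` cyclically is `finRotate n i`. -/
def IsLegalLoop {n : ℕ} (v : Fin n → ℝ × ℝ) : Prop :=
  (∀ i, IsLegalMove (v i) (v (finRotate n i))) ∧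
  ∀ i, ¬ Collinear ℝ {v i, v (finRotate n i), v (finRotate n (finRotate n i))}

/-- The length of a loop: the sum of the lengths `det (v i, v (i + 1))` of its moves. -/
def loopLength {n : ℕ} (v : Fin n → ℝ × ℝ) : ℝ :=
  ∑ i, det₂ (v i) (v (finRotate n i))

/-- The dual loop `i ↦ ℓ(v i, v (i + 1))⁻¹ (v (i + 1) - v i)`. -/
noncomputable def dualLoop {n : ℕ} (v : Fin n → ℝ × ℝ) : Fin n → ℝ × ℝ :=
  fun i => (det₂ (v i) (v (finRotate n i)))⁻¹ • (v (finRotate n i) - v i)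

/-- `p` enumerates the vertices of the two-dimensional polytope `P` counterclockwise: each vertex
occurs exactly once, and `P` lies to the left of the directed line from each vertex of the
list to the next one. -/
def IsCounterclockwiseEnum (P : Set (ℝ × ℝ)) {n : ℕ} (p : Fin n → ℝ × ℝ) : Prop :=
  Function.Injective p ∧ Set.range p = P.extremePoints ℝ ∧
  ∀ i, ∀ x ∈ P, 0 ≤ det₂ (p (finRotate n i) - p i) (x - p i)

/-- `p'` is the relaxed vertex of the vertex `p` of the two-dimensional lattice polytope `P`:
it lies on the boundary line `a₁ X + a₂ Y = b + 1` of the relaxed inequality of each of the (two)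
facets `a₁ X + a₂ Y ≤ b` of `P` that contain `p`. -/
def IsRelaxedVertex (P : Set (ℝ × ℝ)) (p p' : ℝ × ℝ) : Prop :=
  ∀ (a : ℤ × ℤ) (b : ℤ), IsFacetInequality P a b → linForm a p = b → linForm a p' = b + 1

/-- `v` is obtained from the cyclic sequence `q` by replacing each maximal block of
cyclically consecutive equal terms by a single term (the last one of the block is kept). -/
def OmitsRepetitions {m n : ℕ} (v : Fin m → ℝ × ℝ) (q : Fin n → ℝ × ℝ) : Prop :=
  ∃ k : Fin m → Fin n, StrictMono k ∧ Set.range k = {i | q i ≠ q (finRotate n i)} ∧ v = q ∘ k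

/-- `v` is the loop `𝒫(Δ)` associated to `Δ`: the cyclic sequence of the vectors
`q i = (p i)⁽⁻¹⁾ - p i`, where `p` enumerates the vertices of `Δ⁽¹⁾` counterclockwise
and `(p i)⁽⁻¹⁾` is the relaxed vertex of `p i`; consecutive repetitions are omitted. -/
def IsAssociatedLoop (Δ : Set (ℝ × ℝ)) {m : ℕ} (v : Fin m → ℝ × ℝ) : Prop :=
  ∃ (n : ℕ) (p p' : Fin n → ℝ × ℝ),
    IsCounterclockwiseEnum (interiorPolytope Δ) p ∧
    (∀ i, IsRelaxedVertex (interiorPolytope Δ) (p i) (p' i)) ∧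
    OmitsRepetitions v (fun i => p' i - p i)

/-!
By maximality `Δ` is obtained from `Δ⁽¹⁾` by moving every edge outwards by lattice distance one.
So `q i` is the lattice vector at height one over the primitive edge vectors on both sides of the
vertex `p i`: the `q i` move along the edges, by `L i ∈ ℤ`, while the edge vectors move along the
`q i`, by `d i > 0`, and this second loop is the dual one. An edge of length `l i` of `Δ⁽¹⁾` becomes
an edge of length `l i + L i` of `Δ`, which gives `r - r⁽¹⁾ = ∑ L i`.

The two lengths add up to 12. The linear maps in `SL₂(ℤ)` that carry a basis `(q i, e i)` of `ℤ²`
to the next one are products of powers of the standard unipotent matrices, and the modular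
discriminant depends only on the lattice. Following its logarithm along the whole loop, `L i`
and `d i` contribute `2πi` each, while one turn around the origin contributes `12 · 2πi`.

The dual loop has at least three moves, each of length at least one, so `ℓ(𝒫) ≤ 9`, and one of the
two lengths is at most 6. The `L i - 1` lattice points strictly inside a move of positive length are
column vectors, whence `r - r⁽¹⁾ - c(Δ)` is at most the number of moves, which is at most `ℓ(𝒫^∨)`.
-/

section LogDiscriminant

open Complex MatrixGroups
open UpperHalfPlane hiding I re im neg_smul

lemma eta_add_one_pow {z : ℂ} (hz : 0 < z.im) :
    ModularForm.eta (z + 1) ^ 24 = ModularForm.eta z ^ 24 := by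
  have h := congrFun ModularForm.discriminant_T_invariant ⟨z, hz⟩
  have hdenom : denom (ModularGroup.T : SL(2, ℤ)) (⟨z, hz⟩ : ℍ) = 1 :=
    (ModularGroup.denom_apply _ _).trans (by simp [ModularGroup.coe_T])
  rw [ModularForm.SL_slash_apply, modular_T_smul, hdenom, one_zpow, mul_one] at h
  simp only [ModularForm.discriminant, coe_vadd, ofReal_one] at h
  rwa [add_comm]

lemma eta_neg_one_div_pow {z : ℂ} (hz : 0 < z.im) :
    ModularForm.eta (-1 / z) ^ 24 = z ^ 12 * ModularForm.eta z ^ 24 := by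
  have hz₀ : z ≠ 0 := by rintro rfl; simp at hz
  have h := congrFun ModularForm.discriminant_S_invariant ⟨z, hz⟩
  rw [ModularForm.SL_slash_apply, modular_S_smul, ModularGroup.denom_S, zpow_neg,
    mul_inv_eq_iff_eq_mul₀ (zpow_ne_zero _ hz₀)] at h
  have hinv : -1 / z = (-z)⁻¹ := by rw [neg_div, one_div, inv_neg]
  rw [hinv, mul_comm]
  exact h

lemma neg_one_div_im_pos {z : ℂ} (hz : 0 < z.im) : 0 < (-1 / z).im := by
  have hz₀ : z ≠ 0 := by rintro rfl; simp at hz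
  rw [neg_div, one_div, neg_im, inv_im, neg_div, neg_neg]
  exact div_pos hz (normSq_pos.2 hz₀)

lemma exists_continuousOn_exp_eq_discriminant : ∃ D : ℂ → ℂ,
    ContinuousOn D upperHalfPlaneSet ∧ ∀ z : ℂ, 0 < z.im → exp (D z) = ModularForm.eta z ^ 24 := by
  have hconv : Convex ℝ upperHalfPlaneSet := convex_halfSpace_im_gt 0
  have hsc : IsSimplyConnected upperHalfPlaneSet := by
    have := hconv.contractibleSpace ⟨I, by simp⟩
    exact (inferInstance : SimplyConnectedSpace upperHalfPlaneSet)
  exact exists_continuousOn_eqOn_exp_comp hsc isOpen_upperHalfPlaneSet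
    (fun z hz ↦ ((ModularForm.differentiableAt_eta_of_mem_upperHalfPlaneSet
      hz).continuousAt.pow 24).continuousWithinAt)
    (by rintro ⟨z, hz, h⟩; exact pow_ne_zero 24 (ModularForm.eta_ne_zero hz) h)

lemma eq_of_exp_eq_of_isPreconnected {X : Type*} [TopologicalSpace X] {U : Set X} {f g : X → ℂ}
    (hU : IsPreconnected U) (hf : ContinuousOn f U) (hg : ContinuousOn g U)
    (hexp : ∀ x ∈ U, exp (f x) = exp (g x)) {a x : X} (ha : a ∈ U) (hx : x ∈ U)
    (hfg : f a = g a) : f x = g x :=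
  isCoveringMap_exp.eqOn_of_comp_eqOn hU hf hg (fun x hx ↦ Subtype.ext (hexp x hx)) ha hfg hx

lemma exists_im_pos_neg_one_div_eq_add_one :
    ∃ ρ : ℂ, 0 < ρ.im ∧ -1 / ρ = ρ + 1 ∧ log ρ = 2 * Real.pi / 3 * I := by
  set ρ : ℂ := exp ((2 * Real.pi / 3 : ℝ) * I) with hρ
  have hpi := Real.pi_pos
  have him : 0 < ρ.im := by
    rw [hρ, exp_ofReal_mul_I_im]
    exact Real.sin_pos_of_pos_of_lt_pi (by positivity) (by linarith)
  have hlog : log ρ = (2 * Real.pi / 3 : ℝ) * I := by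
    rw [hρ, log_exp] <;> simp <;> linarith
  have hcube : ρ ^ 3 = 1 := by
    rw [hρ, ← exp_nat_mul, ← exp_two_pi_mul_I]
    congr 1
    push_cast
    ring
  have hne_one : ρ - 1 ≠ 0 := fun h ↦ by simp [sub_eq_zero.1 h] at him
  have hcyclotomic : ρ ^ 2 + ρ + 1 = 0 := mul_left_cancel₀ hne_one (by linear_combination hcube)
  refine ⟨ρ, him, ?_, by rw [hlog]; push_cast; rfl⟩
  rw [div_eq_iff (exp_ne_zero _)]
  linear_combination -hcyclotomic

lemma apply_add_int_of_apply_add_one {f : ℂ → ℂ} {c : ℂ}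
    (hf : ∀ z : ℂ, 0 < z.im → f (z + 1) = f z + c) {z : ℂ} (hz : 0 < z.im) (k : ℤ) :
    f (z + k) = f z + k * c := by
  induction k with
  | zero => simp
  | succ k ih =>
    have h := hf (z + (k : ℤ)) (by simpa using hz)
    push_cast at h ih ⊢
    rw [← add_assoc, h, ih]
    ring
  | pred k ih =>
    have h := hf (z + (-k - 1 : ℤ)) (by simpa using hz)
    push_cast at h ih ⊢
    rw [add_assoc, sub_add_cancel, ih] at h
    linear_combination -h

/-- The constant is determined at the fixed point `I` of `z ↦ -1 / z`. -/
lemma apply_neg_one_div_of_exp_eq_discriminant {D : ℂ → ℂ} (hD : ContinuousOn D upperHalfPlaneSet)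
    (hexp : ∀ z : ℂ, 0 < z.im → exp (D z) = ModularForm.eta z ^ 24) {z : ℂ} (hz : 0 < z.im) :
    D (-1 / z) = D z + 12 * log z - 6 * Real.pi * I := by
  refine eq_of_exp_eq_of_isPreconnected (f := fun z ↦ D (-1 / z))
    (g := fun z ↦ D z + 12 * log z - 6 * Real.pi * I)
    (convex_halfSpace_im_gt 0).isPreconnected ?_ ?_ ?_ (a := I) (by simp) hz ?_
  · refine hD.comp (continuousOn_const.div continuousOn_id ?_) fun z hz ↦ neg_one_div_im_pos hz
    rintro z hz rfl
    simp at hz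
  · exact (hD.add (continuousOn_const.mul fun z hz ↦
      (continuousAt_clog (Or.inr (ne_of_gt hz))).continuousWithinAt)).sub continuousOn_const
  · intro z hz
    have hz₀ : z ≠ 0 := by rintro rfl; simp at hz
    have hexp6 : exp (6 * Real.pi * I) = 1 := by
      rw [exp_eq_one_iff]; exact ⟨3, by push_cast; ring⟩
    have hexp12 : exp (12 * log z) = z ^ 12 := by
      rw [← Nat.cast_ofNat, exp_nat_mul, exp_log hz₀]
    rw [hexp _ (neg_one_div_im_pos hz), eta_neg_one_div_pow hz, exp_sub, exp_add, hexp6, hexp12,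
      hexp z hz, div_one, mul_comm]
  · have hI : -1 / I = I := by rw [neg_div, one_div, inv_I, neg_neg]
    simp only [hI, log_I]
    ring

/-- The constant is determined at the cube root of unity, where `z + 1 = -1 / z`. -/
lemma apply_add_one_of_exp_eq_discriminant {D : ℂ → ℂ} (hD : ContinuousOn D upperHalfPlaneSet)
    (hexp : ∀ z : ℂ, 0 < z.im → exp (D z) = ModularForm.eta z ^ 24) {z : ℂ} (hz : 0 < z.im) :
    D (z + 1) = D z + 2 * Real.pi * I := by
  obtain ⟨ρ, hρ, hST, hlog⟩ := exists_im_pos_neg_one_div_eq_add_one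
  refine eq_of_exp_eq_of_isPreconnected (f := fun z ↦ D (z + 1))
    (g := fun z ↦ D z + 2 * Real.pi * I) (convex_halfSpace_im_gt 0).isPreconnected ?_
    (hD.add continuousOn_const) ?_ hρ hz ?_
  · exact hD.comp (by fun_prop) fun z hz ↦ by simpa using hz
  · intro z hz
    rw [hexp _ (by simpa using hz), eta_add_one_pow hz, exp_add, exp_two_pi_mul_I, mul_one,
      hexp z hz]
  · rw [← hST, apply_neg_one_div_of_exp_eq_discriminant hD hexp hρ, hlog]
    ring

/-- The point `x + iy` of the complex plane corresponding to the lattice vector `(x, y)`. -/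
def toComplex : ℤ × ℤ →+ ℂ where
  toFun v := ⟨v.1, v.2⟩
  map_zero' := by simp [Complex.ext_iff]
  map_add' v w := by simp [Complex.ext_iff]

lemma toComplex_div_im_pos {e v : ℤ × ℤ} (h : 0 < e.1 * v.2 - e.2 * v.1) :
    0 < (toComplex v / toComplex e).im := by
  have hdet : (0 : ℝ) < e.1 * v.2 - e.2 * v.1 := by exact_mod_cast h
  have he : toComplex e ≠ 0 := by
    intro h₀
    have hre : (e.1 : ℝ) = 0 := congrArg re h₀
    have him : (e.2 : ℝ) = 0 := congrArg im h₀
    simp [hre, him] at hdet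
  rw [div_im, ← sub_div]
  refine div_pos ?_ (normSq_pos.2 he)
  change (0 : ℝ) < v.2 * e.1 - v.1 * e.2
  linarith

lemma arg_mem_Ioo_of_im_pos {z : ℂ} (hz : 0 < z.im) : arg z ∈ Set.Ioo 0 Real.pi :=
  ⟨(arg_nonneg_iff.2 hz.le).lt_of_ne fun h ↦ hz.ne' (arg_eq_zero_iff.1 h.symm).2,
    arg_lt_pi_iff.2 (Or.inr hz.ne')⟩

/-- The branch cut of the logarithm is met exactly when the counterclockwise turn from `e` to `v`,
which is by less than `π`, crosses the negative real axis. -/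
lemma log_add_log_div {e v : ℂ} (h : 0 < (v / e).im) :
    log e + log (v / e) = log v + 2 * Real.pi * I * (if 0 ≤ e.im ∧ v.im < 0 then 1 else 0 : ℤ) := by
  have he : e ≠ 0 := by rintro rfl; simp at h
  have hve : v / e ≠ 0 := fun h₀ ↦ by simp [h₀] at h
  have hmul : e * (v / e) = v := mul_div_cancel₀ v he
  obtain ⟨hpos, hlt⟩ := arg_mem_Ioo_of_im_pos h
  have hle := arg_le_pi e
  have hgt := neg_pi_lt_arg e
  rcases le_or_gt (arg e + arg (v / e)) Real.pi with hsum | hsum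
  · have hmem : arg e + arg (v / e) ∈ Set.Ioc (-Real.pi) Real.pi := ⟨by linarith, hsum⟩
    have harg : arg v = arg e + arg (v / e) := by rw [← hmul, arg_mul he hve hmem, hmul]
    have hnot : ¬(0 ≤ e.im ∧ v.im < 0) := by
      rintro ⟨he', hv'⟩
      linarith [arg_nonneg_iff.2 he', arg_neg_iff.2 hv']
    rw [if_neg hnot, ← log_mul_eq_add_log_iff he hve |>.2 hmem, hmul]
    simp
  · have hlog : log v = log e + log (v / e) - 2 * Real.pi * I := by
      have hexp : exp (log e + log (v / e) - 2 * Real.pi * I) = v := by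
        rw [exp_sub, exp_add, exp_log he, exp_log hve, hmul, exp_two_pi_mul_I, div_one]
      rw [← hexp, log_exp, hexp] <;> simp [log_im] <;> linarith
    have harg : arg v = arg e + arg (v / e) - 2 * Real.pi := by
      simpa [log_im] using congrArg im hlog
    have hcross : 0 ≤ e.im ∧ v.im < 0 :=
      ⟨arg_nonneg_iff.1 (by linarith), arg_neg_iff.1 (by linarith)⟩
    rw [if_pos hcross, hlog]
    push_cast
    ring

/-- For a positively oriented basis `e, v` of a lattice `Λ` in `ℂ`, `2πi G e v` is a logarithm of
the discriminant `Δ(Λ) = e⁻¹² Δ(v / e)`, hence under a change of basis `G` varies by integers. -/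
lemma exists_logDiscriminant_basis : ∃ G : ℤ × ℤ → ℤ × ℤ → ℂ,
    ∀ e v : ℤ × ℤ, e.1 * v.2 - e.2 * v.1 = 1 →
      (∀ k : ℤ, G e (v + k • e) = G e v + k) ∧
      G v (-e) = G e v - 3 + 12 * (if 0 ≤ e.2 ∧ v.2 < 0 then 1 else 0 : ℤ) := by
  obtain ⟨D, hD, hexp⟩ := exists_continuousOn_exp_eq_discriminant
  refine ⟨fun e v ↦ (D (toComplex v / toComplex e) - 12 * log (toComplex e)) / (2 * Real.pi * I),
    fun e v hdet ↦ ?_⟩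
  have him := toComplex_div_im_pos (e := e) (v := v) (by omega)
  have he : toComplex e ≠ 0 := fun h ↦ by simp [h] at him
  have hpi : (Real.pi : ℂ) ≠ 0 := by exact_mod_cast Real.pi_ne_zero
  constructor
  · intro k
    have hdiv : toComplex (v + k • e) / toComplex e = toComplex v / toComplex e + k := by
      rw [map_add, map_zsmul, zsmul_eq_mul, add_div, mul_div_cancel_right₀ _ he]
    simp only [hdiv, apply_add_int_of_apply_add_one
      (fun _ ↦ apply_add_one_of_exp_eq_discriminant hD hexp) him k]
    field_simp
    ring
  · have hdiv : toComplex (-e) / toComplex v = -1 / (toComplex v / toComplex e) := by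
      rw [map_neg, div_div_eq_mul_div, neg_one_mul]
    have hlog := log_add_log_div him
    have hcross : (0 ≤ (toComplex e).im ∧ (toComplex v).im < 0) ↔ 0 ≤ e.2 ∧ v.2 < 0 := by
      simp [toComplex]
    simp only [hcross] at hlog
    simp only [hdiv, apply_neg_one_div_of_exp_eq_discriminant hD hexp him]
    field_simp
    linear_combination 12 * hlog

lemma ite_crossing_eq_sub {a b y d : ℤ} (hd : 0 ≤ d) (h : b = a + d * y) :
    (if 0 ≤ a ∧ b < 0 then 1 else 0 : ℤ)
      = (if 0 ≤ a ∧ y < 0 then 1 else 0) - if 0 ≤ b ∧ y < 0 then 1 else 0 := by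
  rcases lt_or_ge y 0 with hy | hy
  · have := mul_nonpos_of_nonneg_of_nonpos hd hy.le
    split_ifs <;> first | rfl | omega
  · have := mul_nonneg hd hy
    split_ifs <;> first | rfl | omega

/-- The change of basis from `e, -q` to `e', -q'` is a product of two unipotent maps, the second of
which becomes one of the moves of `exists_logDiscriminant_basis` after a rotation. -/
lemma exists_logDiscriminant_step : ∃ G : ℤ × ℤ → ℤ × ℤ → ℂ,
    ∀ (e q e' q' : ℤ × ℤ) (l d : ℤ), q.1 * e.2 - q.2 * e.1 = 1 → q' = q + l • e →
      e' = e - d • q' → 0 ≤ d →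
        G e' q' = G e q - l - d + 12 * (if 0 ≤ e.2 ∧ e'.2 < 0 then 1 else 0 : ℤ) := by
  obtain ⟨G, hG⟩ := exists_logDiscriminant_basis
  refine ⟨fun e q ↦ G e (-q), fun e q e' q' l d hdet hq he hd ↦ ?_⟩
  have hq' : -q' = -q + (-l) • e := by rw [hq, neg_smul, neg_add]
  have he' : -e' = -e + (-d) • -q' := by rw [he, neg_smul_neg]; abel
  have hdet₁ : e.1 * (-q').2 - e.2 * (-q').1 = 1 := by
    simp only [hq, Prod.fst_add, Prod.snd_add, Prod.fst_neg, Prod.snd_neg, Prod.smul_fst,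
      Prod.smul_snd, smul_eq_mul]
    linear_combination hdet
  have hdet₂ : e'.1 * (-q').2 - e'.2 * (-q').1 = 1 := by
    simp only [he, Prod.fst_sub, Prod.snd_sub, Prod.smul_fst, Prod.smul_snd, smul_eq_mul]
    simp only [Prod.fst_neg, Prod.snd_neg] at hdet₁ ⊢
    linear_combination hdet₁
  have hshear := (hG e (-q) (by simpa [mul_comm, ← sub_eq_neg_add] using hdet)).1 (-l)
  have hshear' := (hG (-q') (-e) (by simpa [mul_comm, ← sub_eq_neg_add] using hdet₁)).1 (-d)
  have hcross := ite_crossing_eq_sub (a := e.2) (b := e'.2) (y := (-q').2) hd (by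
    simp only [he, Prod.snd_sub, Prod.snd_neg, Prod.smul_snd, smul_eq_mul]
    ring)
  have hrot := (hG e (-q') hdet₁).2
  have hrot' := (hG e' (-q') hdet₂).2
  rw [← hq'] at hshear
  rw [← he'] at hshear'
  rw [hcross]
  push_cast at hshear hshear' hrot hrot' ⊢
  linear_combination hshear + hshear' - hrot' + hrot

/-- The sum of the logarithms of the discriminant around the cycle telescopes. -/
theorem sum_add_sum_eq_twelve_mul_crossings {ι : Type*} [Fintype ι] (σ : Equiv.Perm ι)
    (e q : ι → ℤ × ℤ) (l d : ι → ℤ) (hdet : ∀ i, (q i).1 * (e i).2 - (q i).2 * (e i).1 = 1)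
    (hq : ∀ i, q (σ i) = q i + l i • e i) (he : ∀ i, e (σ i) = e i - d i • q (σ i))
    (hd : ∀ i, 0 ≤ d i) :
    ∑ i, l i + ∑ i, d i = 12 * ∑ i, (if 0 ≤ (e i).2 ∧ (e (σ i)).2 < 0 then 1 else 0 : ℤ) := by
  obtain ⟨G, hG⟩ := exists_logDiscriminant_step
  have hsum : ∑ i, ((l i : ℂ) + d i
      - 12 * (if 0 ≤ (e i).2 ∧ (e (σ i)).2 < 0 then 1 else 0 : ℤ)) = 0 := by
    rw [← sub_eq_zero.2 (Equiv.sum_comp σ fun i ↦ G (e i) (q i)).symm, ← Finset.sum_sub_distrib]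
    refine Finset.sum_congr rfl fun i _ ↦ ?_
    rw [hG _ _ _ _ _ _ (hdet i) (hq i) (he i) (hd i)]
    ring
  rw [Finset.sum_sub_distrib, Finset.sum_add_distrib, ← Finset.mul_sum, sub_eq_zero] at hsum
  exact_mod_cast hsum

end LogDiscriminant

section CyclicIndices

lemma finRotate_val {n : ℕ} (i : Fin n) : (finRotate n i : ℕ) = (i + 1) % n := by
  have := i.neZero
  rw [finRotate_apply, Fin.val_add, Fin.val_one', Nat.add_mod_mod]

lemma finRotate_induction {n : ℕ} {P : Fin n → Prop} (h : ∀ i, P i → P (finRotate n i))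
    {i : Fin n} (hi : P i) (j : Fin n) : P j := by
  have := i.neZero
  have hiter : P ((finRotate n)^[(j - i).1] i) := Function.Iterate.rec P hi h _
  rwa [← finCycle_eq_finRotate_iterate, finCycle_apply, add_sub_cancel] at hiter

lemma finRotate_backward_induction {n : ℕ} {I : Set (Fin n)} (hI : I.Nonempty) {P : Fin n → Prop}
    (hmem : ∀ i ∈ I, P i) (hnotMem : ∀ i ∉ I, P (finRotate n i) → P i) (i : Fin n) : P i := by
  by_contra hi
  have hnot := finRotate_induction (P := fun i ↦ ¬P i)
    (fun i hi hi' ↦ hi (hnotMem i (fun hiI ↦ hi (hmem i hiI)) hi')) hi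
  obtain ⟨j, hj⟩ := hI
  exact hnot j (hmem j hj)

variable {m n : ℕ} {k : Fin m → Fin n}

/-- The number of terms of `k` with value below `t`. For increasing `k` and modulo `m`, it is the
index of the cyclically first term of `k` with value at least `t`. -/
def countBelow (k : Fin m → Fin n) (t : ℕ) : ℕ :=
  (Finset.univ.filter fun j ↦ (k j : ℕ) < t).card

lemma countBelow_apply (hk : StrictMono k) (j : Fin m) : countBelow k (k j) = j := by
  have hfilter : (Finset.univ.filter fun j' ↦ (k j' : ℕ) < k j) = Finset.Iio j := by
    ext j'; simp [hk.lt_iff_lt]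
  rw [countBelow, hfilter, Fin.card_Iio]

lemma countBelow_apply_add_one (hk : StrictMono k) (j : Fin m) :
    countBelow k (k j + 1) = j + 1 := by
  have hfilter : (Finset.univ.filter fun j' ↦ (k j' : ℕ) < k j + 1) = Finset.Iic j := by
    ext j'; simp [hk.le_iff_le]
  rw [countBelow, hfilter, Fin.card_Iic]

lemma countBelow_add_one_of_notMem_range {i : Fin n} (hi : i ∉ Set.range k) :
    countBelow k (i + 1) = countBelow k i := by
  refine congrArg Finset.card (Finset.filter_congr fun j _ ↦ ?_)
  have : (k j : ℕ) ≠ i := fun h ↦ hi ⟨j, Fin.ext h⟩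
  omega

lemma countBelow_finRotate_mod (k : Fin m → Fin n) (i : Fin n) :
    countBelow k (finRotate n i) % m = countBelow k (i + 1) % m := by
  rw [finRotate_val]
  rcases (Nat.succ_le_of_lt i.2).lt_or_eq with h | h
  · rw [Nat.mod_eq_of_lt h]
  · rw [Nat.succ_eq_add_one] at h
    rw [h, Nat.mod_self]
    simp [countBelow]

lemma exists_cyclic_ceil (hk : StrictMono k) (hm : 0 < m) :
    ∃ r : Fin n → Fin m, (∀ j, r (k j) = j) ∧ (∀ i ∉ Set.range k, r i = r (finRotate n i)) ∧
      ∀ j, r (finRotate n (k j)) = finRotate m j := by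
  refine ⟨fun i ↦ ⟨countBelow k i % m, Nat.mod_lt _ hm⟩, fun j ↦ Fin.ext ?_,
    fun i hi ↦ Fin.ext ?_, fun j ↦ Fin.ext ?_⟩
  · simp only [countBelow_apply hk, Nat.mod_eq_of_lt j.2]
  · simp only [countBelow_finRotate_mod, countBelow_add_one_of_notMem_range hi]
  · refine (countBelow_finRotate_mod k (k j)).trans ?_
    rw [countBelow_apply_add_one hk, finRotate_val]

lemma exists_strictMono_range_eq (I : Set (Fin n)) :
    ∃ (m : ℕ) (k : Fin m → Fin n), StrictMono k ∧ Set.range k = I := by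
  classical
  refine ⟨I.toFinset.card, I.toFinset.orderEmbOfFin rfl, (Finset.orderEmbOfFin _ _).strictMono, ?_⟩
  rw [Finset.range_orderEmbOfFin, Set.coe_toFinset]

lemma exists_mem_periodicPts_of_finite {α : Type*} [Finite α] [Nonempty α] (f : α → α) :
    ∃ x, x ∈ Function.periodicPts f := by
  obtain ⟨x⟩ := ‹Nonempty α›
  obtain ⟨i, j, hij, h⟩ := Finite.exists_ne_map_eq_of_infinite (fun i : ℕ ↦ f^[i] x)
  wlog hlt : i < j generalizing i j
  · exact this j i hij.symm h.symm (by omega)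
  refine ⟨f^[i] x, j - i, by omega, ?_⟩
  rw [Function.IsPeriodicPt, Function.IsFixedPt, ← Function.iterate_add_apply,
    Nat.sub_add_cancel hlt.le, ← h]

lemma exists_injective_cycle {α : Type*} [Finite α] [Nonempty α] (f : α → α) :
    ∃ (n : ℕ) (x : Fin n → α), 0 < n ∧ Function.Injective x ∧ ∀ i, x (finRotate n i) = f (x i) := by
  obtain ⟨a, ha⟩ := exists_mem_periodicPts_of_finite f
  refine ⟨Function.minimalPeriod f a, fun i ↦ f^[i] a,
    Function.minimalPeriod_pos_of_mem_periodicPts ha, fun i j hij ↦ ?_, fun i ↦ ?_⟩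
  · exact Fin.ext (Function.iterate_injOn_Iio_minimalPeriod i.2 j.2 hij)
  · simp only [finRotate_val, Function.iterate_mod_minimalPeriod_eq, Function.iterate_succ_apply']

end CyclicIndices

section Determinant

lemma det₂_add_left (u v w : ℝ × ℝ) : det₂ (u + v) w = det₂ u w + det₂ v w := by
  simp only [det₂, Prod.fst_add, Prod.snd_add]; ring

lemma det₂_add_right (u v w : ℝ × ℝ) : det₂ u (v + w) = det₂ u v + det₂ u w := by
  simp only [det₂, Prod.fst_add, Prod.snd_add]; ring

lemma det₂_sub_left (u v w : ℝ × ℝ) : det₂ (u - v) w = det₂ u w - det₂ v w := by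
  simp only [det₂, Prod.fst_sub, Prod.snd_sub]; ring

lemma det₂_sub_right (u v w : ℝ × ℝ) : det₂ u (v - w) = det₂ u v - det₂ u w := by
  simp only [det₂, Prod.fst_sub, Prod.snd_sub]; ring

lemma det₂_smul_left (a : ℝ) (u v : ℝ × ℝ) : det₂ (a • u) v = a * det₂ u v := by
  simp only [det₂, Prod.smul_fst, Prod.smul_snd, smul_eq_mul]; ring

lemma det₂_smul_right (a : ℝ) (u v : ℝ × ℝ) : det₂ u (a • v) = a * det₂ u v := by
  simp only [det₂, Prod.smul_fst, Prod.smul_snd, smul_eq_mul]; ring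

lemma det₂_self (u : ℝ × ℝ) : det₂ u u = 0 := by
  simp only [det₂]; ring

lemma det₂_swap (u v : ℝ × ℝ) : det₂ u v = -det₂ v u := by
  simp only [det₂]; ring

lemma det₂_smul_eq (u v g : ℝ × ℝ) : det₂ u v • g = det₂ g v • u + det₂ u g • v := by
  ext <;>
    simp only [det₂, Prod.fst_add, Prod.snd_add, Prod.smul_fst, Prod.smul_snd, smul_eq_mul] <;> ring

lemma eq_of_det₂_ne_zero {u v : ℝ × ℝ} (h : det₂ u v ≠ 0) (g : ℝ × ℝ) :
    g = (det₂ g v / det₂ u v) • u + (det₂ u g / det₂ u v) • v := by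
  rw [← smul_right_inj h, det₂_smul_eq u v g, smul_add, smul_smul, smul_smul,
    mul_div_cancel₀ _ h, mul_div_cancel₀ _ h]

lemma eq_zero_of_det₂_eq_zero {u v y : ℝ × ℝ} (h : det₂ u v ≠ 0) (hu : det₂ y u = 0)
    (hv : det₂ y v = 0) : y = 0 := by
  rw [eq_of_det₂_ne_zero h y, hv, det₂_swap u y, hu]
  simp

lemma exists_smul_of_det₂_eq_zero {u g : ℝ × ℝ} (hu : u ≠ 0) (h : det₂ u g = 0) :
    ∃ t : ℝ, g = t • u := by
  rw [det₂] at h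
  by_cases h₁ : u.1 = 0
  · have h₂ : u.2 ≠ 0 := fun h₂ ↦ hu (Prod.ext h₁ h₂)
    refine ⟨g.2 / u.2, Prod.ext ?_ (by simp [h₂])⟩
    simpa [h₁, h₂] using h
  · refine ⟨g.1 / u.1, Prod.ext (by simp [h₁]) ?_⟩
    rw [Prod.smul_snd, smul_eq_mul, div_mul_eq_mul_div, eq_div_iff h₁]
    linarith

/-- The linear functional `x ↦ det₂ x g`; every functional on the plane is of this form. -/
noncomputable def detLeft (g : ℝ × ℝ) : ℝ × ℝ →L[ℝ] ℝ :=
  g.2 • ContinuousLinearMap.fst ℝ ℝ ℝ - g.1 • ContinuousLinearMap.snd ℝ ℝ ℝ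

@[simp] lemma detLeft_apply (g x : ℝ × ℝ) : detLeft g x = det₂ x g := by
  simp only [detLeft, det₂, sub_apply, smul_apply, ContinuousLinearMap.coe_fst',
    ContinuousLinearMap.coe_snd', smul_eq_mul]
  ring

lemma exists_eq_detLeft (f : ℝ × ℝ →L[ℝ] ℝ) : ∃ g : ℝ × ℝ, f = detLeft g := by
  refine ⟨(-f (0, 1), f (1, 0)), ?_⟩
  ext <;> simp [det₂]

lemma det₂_le_of_mem_convexHull {A : Set (ℝ × ℝ)} {g : ℝ × ℝ} {c : ℝ}
    (h : ∀ x ∈ A, det₂ x g ≤ c) {x : ℝ × ℝ} (hx : x ∈ convexHull ℝ A) : det₂ x g ≤ c := by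
  have hconv : Convex ℝ {x | detLeft g x ≤ c} :=
    convex_halfSpace_le (detLeft g).toLinearMap.isLinear c
  simpa only [Set.mem_ofPred_eq, detLeft_apply] using
    convexHull_min (fun x hx ↦ by simpa only [Set.mem_ofPred_eq, detLeft_apply] using h x hx)
      hconv hx

lemma exists_det₂_lt_of_notMem_convexHull {A : Set (ℝ × ℝ)} (hA : A.Finite) {x : ℝ × ℝ}
    (hx : x ∉ convexHull ℝ A) : ∃ g, ∀ y ∈ A, det₂ y g < det₂ x g := by
  obtain ⟨f, s, hs, hsx⟩ := geometric_hahn_banach_closed_point (convex_convexHull ℝ _)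
    (hA.isClosed_convexHull ℝ) hx
  obtain ⟨g, rfl⟩ := exists_eq_detLeft f
  simp only [detLeft_apply] at hs hsx
  exact ⟨g, fun y hy ↦ (hs y (subset_convexHull ℝ _ hy)).trans hsx⟩

lemma collinear_of_det₂_eq_zero {A : Set (ℝ × ℝ)} {p u : ℝ × ℝ} (hu : u ≠ 0)
    (h : ∀ x ∈ A, det₂ u (x - p) = 0) : Collinear ℝ A := by
  rw [collinear_iff_exists_forall_eq_smul_vadd]
  refine ⟨p, u, fun x hx ↦ ?_⟩
  obtain ⟨t, ht⟩ := exists_smul_of_det₂_eq_zero hu (h x hx)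
  exact ⟨t, by rw [← ht, vadd_eq_add, sub_add_cancel]⟩

end Determinant

section CyclicPolygons

lemma det₂_finRotate {n : ℕ} {P u : Fin n → ℝ × ℝ} {k : Fin n → ℝ}
    (hstep : ∀ i, P (finRotate n i) = P i + k i • u i) (i : Fin n) :
    det₂ (P (finRotate n i)) (u i) = det₂ (P i) (u i) := by
  rw [hstep, det₂_add_left, det₂_smul_left, det₂_self, mul_zero, add_zero]

lemma exists_normal_cone {n : ℕ} (hn : 0 < n) {p u : Fin n → ℝ × ℝ} {l : Fin n → ℝ}
    (hl : ∀ i, 0 < l i) (hstep : ∀ i, p (finRotate n i) = p i + l i • u i)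
    (hturn : ∀ i, 0 < det₂ (u i) (u (finRotate n i))) (g : ℝ × ℝ) :
    ∃ (i : Fin n) (a b : ℝ), 0 ≤ a ∧ 0 ≤ b ∧ g = a • u i + b • u (finRotate n i) := by
  have : Nonempty (Fin n) := ⟨⟨0, hn⟩⟩
  obtain ⟨j, hmax⟩ := Finite.exists_max (fun i ↦ det₂ (p i) g)
  obtain ⟨i, rfl⟩ := (finRotate n).surjective j
  refine ⟨i, det₂ g (u (finRotate n i)) / det₂ (u i) (u (finRotate n i)),
    det₂ (u i) g / det₂ (u i) (u (finRotate n i)), div_nonneg ?_ (hturn i).le,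
    div_nonneg ?_ (hturn i).le, eq_of_det₂_ne_zero (hturn i).ne' g⟩
  · have hnext := hmax (finRotate n (finRotate n i))
    rw [hstep, det₂_add_left, det₂_smul_left] at hnext
    rw [det₂_swap]
    nlinarith [hl (finRotate n i)]
  · have hprev := hmax i
    rw [hstep, det₂_add_left, det₂_smul_left] at hprev
    nlinarith [hl i]

lemma mem_convexHull_of_det₂_le {n : ℕ} {u : Fin n → ℝ × ℝ}
    (hcone : ∀ g : ℝ × ℝ, ∃ (i : Fin n) (a b : ℝ),
      0 ≤ a ∧ 0 ≤ b ∧ g = a • u i + b • u (finRotate n i))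
    {P : Fin n → ℝ × ℝ} {x : ℝ × ℝ}
    (hhead : ∀ i, det₂ x (u i) ≤ det₂ (P (finRotate n i)) (u i))
    (htail : ∀ i, det₂ x (u i) ≤ det₂ (P i) (u i)) : x ∈ convexHull ℝ (Set.range P) := by
  by_contra hx
  obtain ⟨g, hg⟩ := exists_det₂_lt_of_notMem_convexHull (Set.finite_range P) hx
  obtain ⟨i, a, b, ha, hb, rfl⟩ := hcone g
  have hlt := hg _ ⟨finRotate n i, rfl⟩
  simp only [det₂_add_right, det₂_smul_right] at hlt
  linarith [mul_le_mul_of_nonneg_left (hhead i) ha,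
    mul_le_mul_of_nonneg_left (htail (finRotate n i)) hb]

lemma det₂_pos_of_extremePoints {Γ : Set (ℝ × ℝ)} (hnc : ¬ Collinear ℝ Γ) {a b c : ℝ × ℝ}
    (ha : a ∈ Γ) (hb : b ∈ Γ.extremePoints ℝ) (hc : c ∈ Γ) (hab : b ≠ a) (hbc : c ≠ b)
    (hleft : ∀ x ∈ Γ, 0 ≤ det₂ (b - a) (x - a)) (hleft' : ∀ x ∈ Γ, 0 ≤ det₂ (c - b) (x - b)) :
    0 < det₂ (b - a) (c - b) := by
  have hu : b - a ≠ 0 := sub_ne_zero.2 hab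
  have hsplit (x : ℝ × ℝ) : det₂ (b - a) (x - a) = det₂ (b - a) (x - b) := by
    rw [← sub_add_sub_cancel x b a, det₂_add_right, det₂_self, add_zero]
  refine (hsplit c ▸ hleft c hc).lt_of_ne fun h₀ ↦ ?_
  obtain ⟨t, ht⟩ := exists_smul_of_det₂_eq_zero hu h₀.symm
  rcases lt_trichotomy t 0 with hneg | rfl | hpos
  · refine hnc (collinear_of_det₂_eq_zero (p := a) hu fun x hx ↦ ?_)
    have h := hleft x hx
    have h' := hleft' x hx
    rw [ht, det₂_smul_left] at h'
    rw [hsplit] at h ⊢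
    nlinarith
  · rw [zero_smul, sub_eq_zero] at ht
    exact hbc ht
  · have hmem : b ∈ openSegment ℝ a c := by
      have hne : 1 + t ≠ 0 := by positivity
      refine ⟨t / (1 + t), 1 / (1 + t), by positivity, by positivity, by field_simp; ring, ?_⟩
      rw [← smul_right_inj hne, eq_add_of_sub_eq ht, smul_add, smul_smul, smul_smul,
        mul_div_cancel₀ _ hne, mul_div_cancel₀ _ hne]
      module
    exact hab (hb.2 ha hc hmem).symm

/-- The clockwisemost vector is the one of largest cotangent relative to `h`. -/
lemma exists_det₂_nonneg_of_det₂_pos {F : Set (ℝ × ℝ)} (hF : F.Finite) (hne : F.Nonempty)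
    {h : ℝ × ℝ} (hpos : ∀ y ∈ F, 0 < det₂ h y) : ∃ x ∈ F, ∀ y ∈ F, 0 ≤ det₂ x y := by
  have hsq : 0 < h.1 ^ 2 + h.2 ^ 2 := by
    obtain ⟨y, hy⟩ := hne
    rcases eq_or_ne h.1 0 with h₁ | h₁
    · have h₂ : h.2 ≠ 0 := fun h₂ ↦ by simpa [det₂, h₁, h₂] using hpos y hy
      positivity
    · positivity
  obtain ⟨x, hx, hmax⟩ :=
    Set.exists_max_image F (fun y ↦ (h.1 * y.1 + h.2 * y.2) / det₂ h y) hF hne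
  refine ⟨x, hx, fun y hy ↦ (mul_nonneg_iff_of_pos_left hsq).1 ?_⟩
  have hcross := hmax y hy
  rw [div_le_div_iff₀ (hpos y hy) (hpos x hx)] at hcross
  have hlagrange : (h.1 ^ 2 + h.2 ^ 2) * det₂ x y
      = (h.1 * x.1 + h.2 * x.2) * det₂ h y - (h.1 * y.1 + h.2 * y.2) * det₂ h x := by
    simp only [det₂]; ring
  linarith

lemma exists_next_vertex {E : Set (ℝ × ℝ)} (hE : E.Finite) {p : ℝ × ℝ}
    (hp : p ∉ convexHull ℝ (E \ {p})) (hne : (E \ {p}).Nonempty) :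
    ∃ x ∈ E, x ≠ p ∧ ∀ y ∈ convexHull ℝ E, 0 ≤ det₂ (x - p) (y - p) := by
  have hfin : (E \ {p}).Finite := hE.sdiff
  obtain ⟨h, hlt⟩ := exists_det₂_lt_of_notMem_convexHull hfin hp
  obtain ⟨_, ⟨x, hx, rfl⟩, hmin⟩ := exists_det₂_nonneg_of_det₂_pos (h := h)
    (hfin.image fun y ↦ y - p) (hne.image _) (by
      rintro _ ⟨y, hy, rfl⟩
      rw [det₂_swap, det₂_sub_left]
      linarith [hlt y hy])
  refine ⟨x, hx.1, hx.2, fun y hy ↦ ?_⟩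
  rw [det₂_swap, det₂_sub_left, neg_sub, sub_nonneg]
  refine det₂_le_of_mem_convexHull (fun z hz ↦ ?_) hy
  rcases eq_or_ne z p with rfl | hzp
  · exact le_rfl
  · have hz := hmin _ ⟨z, ⟨hz, hzp⟩, rfl⟩
    rw [det₂_swap, det₂_sub_left] at hz
    linarith

lemma collinear_convexHull_iff {A : Set (ℝ × ℝ)} :
    Collinear ℝ (convexHull ℝ A) ↔ Collinear ℝ A := by
  rw [Collinear, Collinear, ← direction_affineSpan, affineSpan_convexHull, direction_affineSpan]

lemma finite_extremePoints_convexHull {A : Set (ℝ × ℝ)} (hA : A.Finite) :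
    ((convexHull ℝ A).extremePoints ℝ).Finite :=
  hA.subset extremePoints_convexHull_subset

lemma convexHull_extremePoints_convexHull {A : Set (ℝ × ℝ)} (hA : A.Finite) :
    convexHull ℝ ((convexHull ℝ A).extremePoints ℝ) = convexHull ℝ A := by
  rw [← ((finite_extremePoints_convexHull hA).isClosed_convexHull ℝ).closure_eq]
  exact closure_convexHull_extremePoints (hA.isCompact_convexHull ℝ) (convex_convexHull ℝ A)

lemma subset_convexHull_range_of_left {Γ : Set (ℝ × ℝ)} (hnc : ¬ Collinear ℝ Γ) {n : ℕ}
    (hn : 0 < n) {p : Fin n → ℝ × ℝ} (hp : ∀ i, p i ∈ Γ.extremePoints ℝ)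
    (hne : ∀ i, p (finRotate n i) ≠ p i)
    (hleft : ∀ i, ∀ x ∈ Γ, 0 ≤ det₂ (p (finRotate n i) - p i) (x - p i)) :
    Γ ⊆ convexHull ℝ (Set.range p) := by
  have hcone := exists_normal_cone hn (p := p) (u := fun i ↦ p (finRotate n i) - p i)
    (l := fun _ ↦ 1) (fun _ ↦ one_pos) (fun i ↦ by simp) fun i ↦
      det₂_pos_of_extremePoints hnc (hp i).1 (hp _) (hp _).1 (hne _) (hne _) (hleft _) (hleft _)
  intro x hx
  refine mem_convexHull_of_det₂_le hcone (fun i ↦ ?_) (fun i ↦ ?_)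
  · have h := hleft i x hx
    rw [← sub_add_sub_cancel x (p (finRotate n i)), det₂_add_right, det₂_self, add_zero, det₂_swap,
      det₂_sub_left] at h
    linarith
  · have h := hleft i x hx
    rw [det₂_swap, det₂_sub_left] at h
    linarith

lemma exists_next_extremePoint {A : Set (ℝ × ℝ)} (hA : A.Finite) (hnc : ¬ Collinear ℝ A)
    {p : ℝ × ℝ} (hp : p ∈ (convexHull ℝ A).extremePoints ℝ) :
    ∃ x ∈ (convexHull ℝ A).extremePoints ℝ, x ≠ p ∧
      ∀ y ∈ convexHull ℝ A, 0 ≤ det₂ (x - p) (y - p) := by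
  have hhull := convexHull_extremePoints_convexHull hA
  set E := (convexHull ℝ A).extremePoints ℝ
  have hne : (E \ {p}).Nonempty := by
    by_contra hempty
    rw [Set.not_nonempty_iff_eq_empty, Set.sdiff_eq_empty] at hempty
    refine hnc (collinear_convexHull_iff.1 ?_)
    rw [← hhull, collinear_convexHull_iff]
    exact (collinear_singleton ℝ p).subset hempty
  have hp' := ((convex_convexHull ℝ A).mem_extremePoints_iff_mem_sdiff_convexHull_sdiff.1 hp).2
  rw [← hhull]
  exact exists_next_vertex (finite_extremePoints_convexHull hA)
    (fun h ↦ hp' (convexHull_mono (Set.sdiff_subset_sdiff_left extremePoints_subset) h)) hne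

theorem exists_isCounterclockwiseEnum {A : Set (ℝ × ℝ)} (hA : A.Finite) (hnc : ¬ Collinear ℝ A) :
    ∃ (n : ℕ) (p : Fin n → ℝ × ℝ), IsCounterclockwiseEnum (convexHull ℝ A) p := by
  set Γ := convexHull ℝ A
  have hncΓ : ¬ Collinear ℝ Γ := fun h ↦ hnc (collinear_convexHull_iff.1 h)
  choose next hnext hne hleft using fun p : Γ.extremePoints ℝ ↦ exists_next_extremePoint hA hnc p.2
  have : Finite (Γ.extremePoints ℝ) := finite_extremePoints_convexHull hA
  have : Nonempty (Γ.extremePoints ℝ) := by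
    refine Set.nonempty_coe_sort.2 <| (hA.isCompact_convexHull ℝ).extremePoints_nonempty ?_
    exact Set.nonempty_iff_ne_empty.2 fun h ↦ hncΓ (by
      rw [show Γ = ∅ from h]; exact collinear_empty ℝ (ℝ × ℝ))
  obtain ⟨n, x, hn, hinj, hx⟩ :=
    exists_injective_cycle fun p ↦ (⟨next p, hnext p⟩ : Γ.extremePoints ℝ)
  have hx' (i : Fin n) : (x (finRotate n i) : ℝ × ℝ) = next (x i) := congrArg Subtype.val (hx i)
  have hleft' (i : Fin n) : ∀ y ∈ Γ, 0 ≤ det₂ ((x (finRotate n i) : ℝ × ℝ) - x i) (y - x i) := by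
    rw [hx']
    exact hleft _
  refine ⟨n, fun i ↦ x i, fun i j h ↦ hinj (Subtype.ext h), ?_, hleft'⟩
  refine subset_antisymm (Set.range_subset_iff.2 fun i ↦ (x i).2) fun y hy ↦ ?_
  have hsub : Γ ⊆ convexHull ℝ (Set.range fun i ↦ (x i : ℝ × ℝ)) :=
    subset_convexHull_range_of_left hncΓ hn (fun i ↦ (x i).2) (fun i ↦ by rw [hx']; exact hne _)
      hleft'
  have hsup : convexHull ℝ (Set.range fun i ↦ (x i : ℝ × ℝ)) ⊆ Γ :=
    convexHull_min (Set.range_subset_iff.2 fun i ↦ (x i).2.1) (convex_convexHull ℝ A)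
  rw [subset_antisymm hsub hsup] at hy
  exact extremePoints_convexHull_subset hy

end CyclicPolygons

section PlaneLattice

lemma toPlane_sub (v w : ℤ × ℤ) : toPlane (v - w) = toPlane v - toPlane w := by
  ext <;> simp [toPlane]

lemma toPlane_add (v w : ℤ × ℤ) : toPlane (v + w) = toPlane v + toPlane w := by
  ext <;> simp [toPlane]

lemma toPlane_zsmul (a : ℤ) (v : ℤ × ℤ) : toPlane (a • v) = (a : ℝ) • toPlane v := by
  ext <;> simp [toPlane]

lemma toPlane_neg (v : ℤ × ℤ) : toPlane (-v) = -toPlane v := by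
  ext <;> simp [toPlane]

lemma toPlane_zero : toPlane 0 = 0 := by
  ext <;> simp [toPlane]

lemma toPlane_injective : Function.Injective toPlane := fun v w h ↦ by
  simpa [toPlane, Prod.ext_iff] using h

lemma det₂_toPlane (v w : ℤ × ℤ) :
    det₂ (toPlane v) (toPlane w) = ((v.1 * w.2 - v.2 * w.1 : ℤ) : ℝ) := by
  simp [det₂, toPlane]

lemma toPlane_ne_zero_of_isCoprime {e : ℤ × ℤ} (he : IsCoprime e.1 e.2) : toPlane e ≠ 0 := by
  rw [← toPlane_zero, toPlane_injective.ne_iff]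
  rintro rfl
  exact not_isCoprime_zero_zero he

lemma exists_eq_smul_isCoprime {w : ℤ × ℤ} (hw : w ≠ 0) :
    ∃ (l : ℤ) (e : ℤ × ℤ), 0 < l ∧ IsCoprime e.1 e.2 ∧ w = l • e := by
  have hgcd : 0 < Int.gcd w.1 w.2 := by
    rwa [Int.gcd_pos_iff, ← not_and_or, ← Prod.mk_eq_zero]
  obtain ⟨a, b, hab, ha, hb⟩ := Int.exists_gcd_one hgcd
  exact ⟨Int.gcd w.1 w.2, (a, b), by exact_mod_cast hgcd, Int.isCoprime_iff_gcd_eq_one.2 hab,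
    Prod.ext (ha.trans (mul_comm _ _)) (hb.trans (mul_comm _ _))⟩

lemma exists_eq_smul_of_isCoprime {e f : ℤ × ℤ} (he : IsCoprime e.1 e.2)
    (h : e.1 * f.2 - e.2 * f.1 = 0) : ∃ t : ℤ, f = t • e := by
  obtain ⟨a, b, hab⟩ := he
  refine ⟨a * f.1 + b * f.2, Prod.ext ?_ ?_⟩
  · simp only [Prod.smul_fst, smul_eq_mul]
    linear_combination (-f.1) * hab - b * h
  · simp only [Prod.smul_snd, smul_eq_mul]
    linear_combination (-f.2) * hab + a * h

lemma eq_or_eq_neg_of_isCoprime {e f : ℤ × ℤ} (he : IsCoprime e.1 e.2) (hf : IsCoprime f.1 f.2)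
    (h : e.1 * f.2 - e.2 * f.1 = 0) : f = e ∨ f = -e := by
  obtain ⟨t, rfl⟩ := exists_eq_smul_of_isCoprime he h
  obtain ⟨a, b, hab⟩ := hf
  simp only [Prod.smul_fst, Prod.smul_snd, smul_eq_mul] at hab
  have ht : IsUnit t := IsUnit.of_mul_eq_one (a * e.1 + b * e.2) (by linear_combination hab)
  rcases Int.isUnit_iff.1 ht with rfl | rfl
  · exact Or.inl (one_smul _ _)
  · exact Or.inr (neg_one_smul _ _)

lemma exists_int_of_smul_toPlane {e z : ℤ × ℤ} (he : IsCoprime e.1 e.2) {t : ℝ}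
    (h : toPlane z = t • toPlane e) : ∃ k : ℤ, t = k := by
  obtain ⟨a, b, hab⟩ := he
  have hab' : (a : ℝ) * e.1 + b * e.2 = 1 := by exact_mod_cast hab
  obtain ⟨hfst, hsnd⟩ := Prod.ext_iff.1 h
  simp only [toPlane, Prod.smul_fst, Prod.smul_snd, smul_eq_mul] at hfst hsnd
  refine ⟨a * z.1 + b * z.2, ?_⟩
  push_cast
  rw [hfst, hsnd]
  linear_combination (-t) * hab'

end PlaneLattice

section HalfPlanes

lemma detLeft_surjective {g : ℝ × ℝ} (hg : g ≠ 0) : Function.Surjective (detLeft g) := by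
  refine LinearMap.surjective (f := (detLeft g).toLinearMap) fun h₀ ↦ hg ?_
  have hfst := congrArg (fun f ↦ f (0, 1)) h₀
  have hsnd := congrArg (fun f ↦ f (1, 0)) h₀
  simp only [ContinuousLinearMap.coe_coe, detLeft_apply, det₂, LinearMap.zero_apply, zero_mul,
    one_mul, zero_sub, sub_zero, neg_eq_zero] at hfst hsnd
  exact Prod.ext hfst hsnd

lemma mem_frontier_iff_of_det₂_le {ι : Type*} [Finite ι] {u P : ι → ℝ × ℝ} (hu : ∀ i, u i ≠ 0)
    {K : Set (ℝ × ℝ)} (hK : ∀ x, x ∈ K ↔ ∀ i, det₂ x (u i) ≤ det₂ (P i) (u i)) (x : ℝ × ℝ) :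
    x ∈ frontier K ↔ x ∈ K ∧ ∃ i, det₂ x (u i) = det₂ (P i) (u i) := by
  have hKeq : K = ⋂ i, detLeft (u i) ⁻¹' Set.Iic (det₂ (P i) (u i)) := by
    ext x; simp [hK]
  have hclosed : IsClosed K := by
    rw [hKeq]
    exact isClosed_iInter fun i ↦ isClosed_Iic.preimage (detLeft _).continuous
  have hint : interior K = ⋂ i, detLeft (u i) ⁻¹' Set.Iio (det₂ (P i) (u i)) := by
    rw [hKeq, interior_iInter_of_finite]
    refine Set.iInter_congr fun i ↦ ?_
    rw [← ((detLeft (u i)).isOpenMap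
      (detLeft_surjective (hu i))).preimage_interior_eq_interior_preimage (detLeft _).continuous,
      interior_Iic]
  rw [hclosed.frontier_eq, Set.mem_sdiff, hint, hK]
  refine and_congr_right fun hx ↦ ?_
  simp only [Set.mem_iInter, Set.mem_preimage, Set.mem_Iio, detLeft_apply, not_forall, not_lt]
  exact exists_congr fun i ↦ ⟨fun h ↦ le_antisymm (hx i) h, fun h ↦ h.ge⟩

end HalfPlanes

section EdgeData

/-- `p`, `e` and `l` are the vertices, the primitive edge vectors and the lattice lengths of the
edges of the lattice polygon `Γ`, in counterclockwise order: edge `i` goes from `p i` to the next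
vertex. Since `Γ` lies to the left of its edges, `x ↦ det₂ x (e i)` is maximal on edge `i`. -/
structure IsEdgeData (Γ : Set (ℝ × ℝ)) {n : ℕ} (p : Fin n → ℝ × ℝ) (e : Fin n → ℤ × ℤ)
    (l : Fin n → ℤ) : Prop where
  pos : 0 < n
  hull : Γ = convexHull ℝ (Set.range p)
  injective : Function.Injective p
  lattice : ∀ i, p i ∈ Set.range toPlane
  isCoprime : ∀ i, IsCoprime (e i).1 (e i).2
  step : ∀ i, p (finRotate n i) = p i + (l i : ℝ) • toPlane (e i)
  length_pos : ∀ i, 0 < l i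
  turn : ∀ i, 0 < det₂ (toPlane (e i)) (toPlane (e (finRotate n i)))
  left : ∀ i, ∀ x ∈ Γ, det₂ x (toPlane (e i)) ≤ det₂ (p i) (toPlane (e i))

variable {n : ℕ} {p : Fin n → ℝ × ℝ}

lemma finRotate_ne_self (hn : 2 ≤ n) (i : Fin n) : finRotate n i ≠ i :=
  Equiv.Perm.mem_support.1 (by simp [support_finRotate_of_le hn])

lemma two_le_of_not_collinear_range (hnc : ¬ Collinear ℝ (Set.range p)) : 2 ≤ n := by
  by_contra hn
  have : Subsingleton (Fin n) := Fin.subsingleton_iff_le_one.2 (by omega)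
  exact hnc ((Set.subsingleton_range p).induction_on (collinear_empty ℝ _) (collinear_singleton ℝ))

lemma exists_primitive_step {a b : ℝ × ℝ} (ha : a ∈ Set.range toPlane)
    (hb : b ∈ Set.range toPlane) (hab : b ≠ a) :
    ∃ (l : ℤ) (e : ℤ × ℤ), 0 < l ∧ IsCoprime e.1 e.2 ∧ b - a = (l : ℝ) • toPlane e := by
  obtain ⟨a, rfl⟩ := ha
  obtain ⟨b, rfl⟩ := hb
  obtain ⟨l, e, hl, he, h⟩ := exists_eq_smul_isCoprime (sub_ne_zero.2 (ne_of_apply_ne _ hab))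
  exact ⟨l, e, hl, he, by rw [← toPlane_sub, h, toPlane_zsmul]⟩

theorem IsCounterclockwiseEnum.exists_isEdgeData {A : Set (ℝ × ℝ)} (hA : A.Finite)
    (hAZ : A ⊆ Set.range toPlane) (hnc : ¬ Collinear ℝ A)
    (hp : IsCounterclockwiseEnum (convexHull ℝ A) p) :
    ∃ e l, IsEdgeData (convexHull ℝ A) p e l := by
  obtain ⟨hinj, hrange, hleft⟩ := hp
  have hhull : convexHull ℝ A = convexHull ℝ (Set.range p) := by
    rw [hrange, convexHull_extremePoints_convexHull hA]
  have hextreme (i : Fin n) : p i ∈ (convexHull ℝ A).extremePoints ℝ := hrange ▸ ⟨i, rfl⟩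
  have hlattice (i : Fin n) : p i ∈ Set.range toPlane :=
    hAZ (extremePoints_convexHull_subset (hextreme i))
  have hncΓ : ¬ Collinear ℝ (convexHull ℝ A) := collinear_convexHull_iff.not.2 hnc
  have hn : 2 ≤ n := two_le_of_not_collinear_range (p := p) <| by
    rwa [← collinear_convexHull_iff, ← hhull]
  have hne (i : Fin n) : p (finRotate n i) ≠ p i := hinj.ne (finRotate_ne_self hn i)
  choose l e hl he hle using fun i ↦ exists_primitive_step (hlattice i) (hlattice _) (hne i)
  have hl' (i : Fin n) : (0 : ℝ) < l i := by exact_mod_cast hl i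
  refine ⟨e, l, by omega, hhull, hinj, hlattice, he, fun i ↦ eq_add_of_sub_eq' (hle i), hl,
    fun i ↦ ?_, fun i x hx ↦ ?_⟩
  · have hturn := det₂_pos_of_extremePoints hncΓ (hextreme i).1 (hextreme _) (hextreme _).1
      (hne i) (hne _) (hleft _) (hleft _)
    rwa [hle, hle, det₂_smul_left, det₂_smul_right, mul_pos_iff_of_pos_left (hl' _),
      mul_pos_iff_of_pos_left (hl' _)] at hturn
  · have hx := hleft i x hx
    rw [hle, det₂_smul_left, mul_nonneg_iff_of_pos_left (hl' i), det₂_sub_right] at hx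
    rw [det₂_swap x, det₂_swap (p i)]
    linarith

end EdgeData

namespace IsEdgeData

variable {Γ : Set (ℝ × ℝ)} {n : ℕ} {p : Fin n → ℝ × ℝ} {e : Fin n → ℤ × ℤ} {l : Fin n → ℤ}

lemma exists_normal_cone (D : IsEdgeData Γ p e l) (g : ℝ × ℝ) : ∃ (i : Fin n) (a b : ℝ),
    0 ≤ a ∧ 0 ≤ b ∧ g = a • toPlane (e i) + b • toPlane (e (finRotate n i)) :=
  _root_.exists_normal_cone D.pos (u := fun i ↦ toPlane (e i)) (l := fun i ↦ (l i : ℝ))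
    (fun i ↦ by exact_mod_cast D.length_pos i) D.step D.turn g

lemma edge_ne_zero (D : IsEdgeData Γ p e l) (i : Fin n) : toPlane (e i) ≠ 0 :=
  toPlane_ne_zero_of_isCoprime (D.isCoprime i)

lemma cast_length_pos (D : IsEdgeData Γ p e l) (i : Fin n) : (0 : ℝ) < l i := by
  exact_mod_cast D.length_pos i

lemma vertex_mem (D : IsEdgeData Γ p e l) (i : Fin n) : p i ∈ Γ := by
  rw [D.hull]
  exact subset_convexHull ℝ _ ⟨i, rfl⟩

lemma mem_convexHull_of_det₂_le (D : IsEdgeData Γ p e l) {P : Fin n → ℝ × ℝ} {k : Fin n → ℝ}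
    (hstep : ∀ i, P (finRotate n i) = P i + k i • toPlane (e i)) {x : ℝ × ℝ}
    (hx : ∀ i, det₂ x (toPlane (e i)) ≤ det₂ (P i) (toPlane (e i))) :
    x ∈ convexHull ℝ (Set.range P) :=
  _root_.mem_convexHull_of_det₂_le (u := fun i ↦ toPlane (e i)) D.exists_normal_cone
    (fun i ↦ (hx i).trans_eq (det₂_finRotate (u := fun i ↦ toPlane (e i)) hstep i).symm) hx

lemma det₂_succ (D : IsEdgeData Γ p e l) (i : Fin n) :
    det₂ (p (finRotate n i)) (toPlane (e i)) = det₂ (p i) (toPlane (e i)) :=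
  det₂_finRotate (u := fun i ↦ toPlane (e i)) D.step i

lemma mem_iff (D : IsEdgeData Γ p e l) (x : ℝ × ℝ) :
    x ∈ Γ ↔ ∀ i, det₂ x (toPlane (e i)) ≤ det₂ (p i) (toPlane (e i)) :=
  ⟨fun hx i ↦ D.left i x hx, fun h ↦ by rw [D.hull]; exact D.mem_convexHull_of_det₂_le D.step h⟩

lemma eq_vertex (D : IsEdgeData Γ p e l) {i : Fin n} {g x : ℝ × ℝ}
    (hpos : 0 < det₂ (toPlane (e i)) g) (hneg : det₂ (toPlane (e (finRotate n i))) g < 0)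
    (hx : x ∈ Γ) (hxg : det₂ (p (finRotate n i)) g ≤ det₂ x g) : x = p (finRotate n i) := by
  have hprev : det₂ (x - p (finRotate n i)) (toPlane (e i)) ≤ 0 := by
    rw [det₂_sub_left, D.det₂_succ]
    linarith [D.left i x hx]
  have hnext : det₂ (x - p (finRotate n i)) (toPlane (e (finRotate n i))) ≤ 0 := by
    rw [det₂_sub_left]
    linarith [D.left (finRotate n i) x hx]
  have hg : 0 ≤ det₂ (x - p (finRotate n i)) g := by
    rw [det₂_sub_left]
    linarith
  have hexpand := congrArg (det₂ (x - p (finRotate n i)))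
    (det₂_smul_eq (toPlane (e i)) (toPlane (e (finRotate n i))) g)
  simp only [det₂_smul_right, det₂_add_right] at hexpand
  rw [det₂_swap g] at hexpand
  have hg' := mul_nonneg (D.turn i).le hg
  have hprev' := mul_nonpos_of_nonneg_of_nonpos (neg_pos.2 hneg).le hprev
  have hnext' := mul_nonpos_of_nonneg_of_nonpos hpos.le hnext
  refine sub_eq_zero.1 (eq_zero_of_det₂_eq_zero (D.turn i).ne' ?_ ?_)
  · exact (mul_eq_zero.1 (by linarith)).resolve_left (neg_pos.2 hneg).ne'
  · exact (mul_eq_zero.1 (by linarith)).resolve_left hpos.ne'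

lemma vertex_succ_ne (D : IsEdgeData Γ p e l) (i : Fin n) : p (finRotate n i) ≠ p i := by
  rw [D.step, Ne, add_eq_left]
  exact smul_ne_zero (D.cast_length_pos i).ne' (D.edge_ne_zero i)

lemma det₂_succ_nonneg_of_det₂_pos (D : IsEdgeData Γ p e l) {i j : Fin n}
    (hpos : 0 < det₂ (toPlane (e i)) (toPlane (e j))) :
    0 ≤ det₂ (toPlane (e (finRotate n i))) (toPlane (e j)) := by
  by_contra! hneg
  have hle := D.left j _ (D.vertex_mem (finRotate n i))
  have htail := D.eq_vertex hpos hneg (D.vertex_mem j) hle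
  have hhead := D.eq_vertex hpos hneg (D.vertex_mem (finRotate n j)) (by rwa [D.det₂_succ])
  exact D.vertex_succ_ne j (hhead.trans htail.symm)

lemma sum_smul_eq_zero (D : IsEdgeData Γ p e l) : ∑ i, (l i : ℝ) • toPlane (e i) = 0 := by
  simp only [fun i ↦ (sub_eq_of_eq_add' (D.step i)).symm]
  rw [Finset.sum_sub_distrib, Equiv.sum_comp (finRotate n) p, sub_self]

lemma sum_mul_det₂_eq_zero (D : IsEdgeData Γ p e l) (x : ℝ × ℝ) :
    ∑ i, (l i : ℝ) * det₂ x (toPlane (e i)) = 0 := by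
  have h := congrArg (detLeft x) D.sum_smul_eq_zero
  simp only [map_sum, map_smul, map_zero, detLeft_apply, smul_eq_mul] at h
  rw [← neg_eq_zero, ← Finset.sum_neg_distrib, ← h]
  exact Finset.sum_congr rfl fun i _ ↦ by rw [det₂_swap x, mul_neg, neg_neg]

/-- The centroid of the vertices is such a point. -/
lemma exists_forall_det₂_lt (D : IsEdgeData Γ p e l) :
    ∃ y, ∀ i, det₂ y (toPlane (e i)) < det₂ (p i) (toPlane (e i)) := by
  have hn : (0 : ℝ) < n := by exact_mod_cast D.pos
  refine ⟨(n : ℝ)⁻¹ • ∑ j, p j, fun i ↦ ?_⟩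
  have hsum : det₂ (∑ j, p j) (toPlane (e i)) = ∑ j, det₂ (p j) (toPlane (e i)) := by
    simp only [← detLeft_apply, map_sum]
  have hconst : (n : ℝ) * det₂ (p i) (toPlane (e i))
      = ∑ _j : Fin n, det₂ (p i) (toPlane (e i)) := by simp
  rw [det₂_smul_left, inv_mul_lt_iff₀ hn, hsum, hconst]
  refine Finset.sum_lt_sum (fun j _ ↦ D.left i _ (D.vertex_mem j))
    ⟨finRotate n (finRotate n i), Finset.mem_univ _, ?_⟩
  rw [D.step, det₂_add_left, D.det₂_succ, det₂_smul_left, det₂_swap (toPlane (e (finRotate n i)))]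
  linarith [mul_pos (D.cast_length_pos (finRotate n i)) (D.turn i)]

lemma exists_eq_add_smul (D : IsEdgeData Γ p e l) {P : Fin n → ℝ × ℝ} {k : Fin n → ℝ}
    (hstep : ∀ i, P (finRotate n i) = P i + k i • toPlane (e i)) {x : ℝ × ℝ}
    (hx : ∀ i, det₂ x (toPlane (e i)) ≤ det₂ (P i) (toPlane (e i))) {i : Fin n}
    (hi : det₂ x (toPlane (e i)) = det₂ (P i) (toPlane (e i))) :
    ∃ t : ℝ, 0 ≤ t ∧ t ≤ k i ∧ x = P i + t • toPlane (e i) := by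
  have hparallel : det₂ (toPlane (e i)) (x - P i) = 0 := by
    rw [det₂_swap, det₂_sub_left, hi, sub_self, neg_zero]
  obtain ⟨t, ht⟩ := exists_smul_of_det₂_eq_zero (D.edge_ne_zero i) hparallel
  obtain rfl : x = P i + t • toPlane (e i) := eq_add_of_sub_eq' ht
  refine ⟨t, ?_, ?_, rfl⟩
  · obtain ⟨j, rfl⟩ := (finRotate n).surjective i
    have hprev := hx j
    rw [det₂_add_left, det₂_finRotate (u := fun i ↦ toPlane (e i)) hstep, det₂_smul_left,
      det₂_swap (toPlane (e (finRotate n j)))] at hprev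
    nlinarith [D.turn j]
  · have hnext := hx (finRotate n i)
    rw [hstep, det₂_add_left, det₂_add_left, det₂_smul_left, det₂_smul_left] at hnext
    exact le_of_mul_le_mul_right (by linarith) (D.turn i)

lemma edge_injective (D : IsEdgeData Γ p e l) : Function.Injective e := by
  intro i j hij
  have hsupport : det₂ (p j) (toPlane (e i)) = det₂ (p i) (toPlane (e i)) :=
    (D.left i _ (D.vertex_mem j)).antisymm (by rw [hij]; exact D.left j _ (D.vertex_mem i))
  obtain ⟨t, ht, -, hj⟩ := D.exists_eq_add_smul D.step (D.left · _ (D.vertex_mem j)) hsupport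
  obtain ⟨s, hs, -, hi⟩ := D.exists_eq_add_smul D.step (D.left · _ (D.vertex_mem i))
    (i := j) (by rw [← hij, hsupport])
  rw [hj, ← hij, add_assoc, ← add_smul, left_eq_add, smul_eq_zero_iff_left (D.edge_ne_zero i)] at hi
  obtain rfl : t = 0 := by linarith
  exact D.injective (by rw [hj, zero_smul, add_zero])

end IsEdgeData

section ParallelPolygons

/-- `K` is a lattice polygon with interior, cut out by half-planes with boundary directions `e i`;
its vertices, possibly with repetitions, are the `P i`, and its edges have lattice lengths `k i`,
possibly zero. Both a polygon with edge vectors `e` and its relaxation have this form. -/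
structure IsParallelPolygon {n : ℕ} (e : Fin n → ℤ × ℤ) (K : Set (ℝ × ℝ)) (P : Fin n → ℝ × ℝ)
    (k : Fin n → ℤ) : Prop where
  lattice : ∀ i, P i ∈ Set.range toPlane
  step : ∀ i, P (finRotate n i) = P i + (k i : ℝ) • toPlane (e i)
  mem_iff : ∀ x, x ∈ K ↔ ∀ i, det₂ x (toPlane (e i)) ≤ det₂ (P i) (toPlane (e i))
  vertex_mem : ∀ i, P i ∈ K
  exists_lt : ∃ y, ∀ i, det₂ y (toPlane (e i)) < det₂ (P i) (toPlane (e i))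

/-- The lattice points `z i + s • e i` with `0 ≤ s < k i`, which enumerate the boundary of a
polygon with vertices `z i`; the head of each edge is counted on a later edge. -/
def edgePoint {n : ℕ} (z e : Fin n → ℤ × ℤ) (k : Fin n → ℤ) (a : Σ i, Fin (k i).toNat) : ℤ × ℤ :=
  z a.1 + ((a.2 : ℕ) : ℤ) • e a.1

variable {Γ K : Set (ℝ × ℝ)} {n : ℕ} {p P : Fin n → ℝ × ℝ} {z e : Fin n → ℤ × ℤ} {l k : Fin n → ℤ}

lemma IsEdgeData.isParallelPolygon (D : IsEdgeData Γ p e l) : IsParallelPolygon e Γ p l :=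
  ⟨D.lattice, D.step, D.mem_iff, D.vertex_mem, D.exists_forall_det₂_lt⟩

namespace IsParallelPolygon

lemma length_nonneg (Q : IsParallelPolygon e K P k) (D : IsEdgeData Γ p e l) (i : Fin n) :
    0 ≤ k i := by
  obtain ⟨t, ht₀, ht, -⟩ :=
    D.exists_eq_add_smul Q.step ((Q.mem_iff _).1 (Q.vertex_mem i)) (i := i) rfl
  exact_mod_cast ht₀.trans ht

lemma convex (Q : IsParallelPolygon e K P k) : Convex ℝ K := by
  have hK : K = ⋂ i, {x | detLeft (toPlane (e i)) x ≤ detLeft (toPlane (e i)) (P i)} := by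
    ext x
    simp [Q.mem_iff]
  rw [hK]
  exact convex_iInter fun i ↦ convex_halfSpace_le (detLeft _).toLinearMap.isLinear _

lemma eq_of_det₂_eq_zero (Q : IsParallelPolygon e K P k) (D : IsEdgeData Γ p e l) {x : ℝ × ℝ}
    {i j : Fin n} (hi : det₂ x (toPlane (e i)) = det₂ (P i) (toPlane (e i)))
    (hj : det₂ x (toPlane (e j)) = det₂ (P j) (toPlane (e j)))
    (hij : det₂ (toPlane (e i)) (toPlane (e j)) = 0) : i = j := by
  rw [det₂_toPlane, Int.cast_eq_zero] at hij
  rcases eq_or_eq_neg_of_isCoprime (D.isCoprime i) (D.isCoprime j) hij with h | h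
  · exact D.edge_injective h.symm
  · obtain ⟨y, hy⟩ := Q.exists_lt
    have hneg (w : ℝ × ℝ) : det₂ w (toPlane (e j)) = -det₂ w (toPlane (e i)) := by
      rw [h, toPlane_neg, ← neg_one_smul ℝ, det₂_smul_right, neg_one_mul]
    have hyi := hy i
    have hyj := hy j
    rw [← hi] at hyi
    rw [← hj, hneg, hneg] at hyj
    linarith

lemma exists_det₂_ne (Q : IsParallelPolygon e K P k) (D : IsEdgeData Γ p e l) (x : ℝ × ℝ) :
    ∃ i, det₂ x (toPlane (e i)) ≠ det₂ (P i) (toPlane (e i)) := by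
  by_contra! hall
  obtain ⟨y, hy⟩ := Q.exists_lt
  have hlt : ∑ i, (l i : ℝ) * det₂ y (toPlane (e i)) < ∑ i, (l i : ℝ) * det₂ x (toPlane (e i)) := by
    refine Finset.sum_lt_sum_of_nonempty ⟨⟨0, D.pos⟩, Finset.mem_univ _⟩ fun j _ ↦ ?_
    rw [hall j]
    exact mul_lt_mul_of_pos_left (hy j) (D.cast_length_pos j)
  rw [D.sum_mul_det₂_eq_zero, D.sum_mul_det₂_eq_zero] at hlt
  exact lt_irrefl _ hlt

lemma cast_lt_length (a : Σ i, Fin (k i).toNat) : ((a.2 : ℕ) : ℝ) < k a.1 := by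
  have h : ((a.2 : ℕ) : ℤ) < k a.1 := by have := a.2.2; omega
  exact_mod_cast h

lemma toPlane_edgePoint (hz : ∀ i, toPlane (z i) = P i) (a : Σ i, Fin (k i).toNat) :
    toPlane (edgePoint z e k a) = P a.1 + ((a.2 : ℕ) : ℝ) • toPlane (e a.1) := by
  rw [edgePoint, toPlane_add, toPlane_zsmul, hz, Int.cast_natCast]

lemma det₂_edgePoint (hz : ∀ i, toPlane (z i) = P i) (a : Σ i, Fin (k i).toNat) :
    det₂ (toPlane (edgePoint z e k a)) (toPlane (e a.1)) = det₂ (P a.1) (toPlane (e a.1)) := by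
  rw [toPlane_edgePoint hz, det₂_add_left, det₂_smul_left, det₂_self, mul_zero, add_zero]

lemma edgePoint_mem (Q : IsParallelPolygon e K P k) (hz : ∀ i, toPlane (z i) = P i)
    (a : Σ i, Fin (k i).toNat) : toPlane (edgePoint z e k a) ∈ K := by
  have hlt := cast_lt_length a
  have hk : (0 : ℝ) < k a.1 := (Nat.cast_nonneg _).trans_lt hlt
  have hmem := Q.convex.add_smul_sub_mem (Q.vertex_mem a.1) (Q.vertex_mem (finRotate n a.1))
    ⟨div_nonneg (Nat.cast_nonneg (a.2 : ℕ)) hk.le, (div_le_one hk).2 hlt.le⟩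
  rwa [Q.step, add_sub_cancel_left, smul_smul, div_mul_cancel₀ _ hk.ne',
    ← toPlane_edgePoint hz] at hmem

lemma det₂_nonpos_of_edgePoint_eq (Q : IsParallelPolygon e K P k)
    (hz : ∀ i, toPlane (z i) = P i) {a b : Σ i, Fin (k i).toNat}
    (hab : edgePoint z e k a = edgePoint z e k b) :
    det₂ (toPlane (e a.1)) (toPlane (e b.1)) ≤ 0 := by
  have hhead := (Q.mem_iff _).1 (Q.vertex_mem (finRotate n a.1)) b.1
  rw [← det₂_edgePoint hz b, ← hab, toPlane_edgePoint hz, Q.step, det₂_add_left, det₂_add_left,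
    det₂_smul_left, det₂_smul_left] at hhead
  nlinarith [cast_lt_length a]

lemma edgePoint_injective (Q : IsParallelPolygon e K P k) (D : IsEdgeData Γ p e l)
    (hz : ∀ i, toPlane (z i) = P i) : Function.Injective (edgePoint z e k) := by
  rintro ⟨i, s⟩ ⟨j, t⟩ hab
  have hle := Q.det₂_nonpos_of_edgePoint_eq hz hab
  have hge := Q.det₂_nonpos_of_edgePoint_eq hz hab.symm
  rw [det₂_swap] at hge
  obtain rfl : i = j := Q.eq_of_det₂_eq_zero D (det₂_edgePoint hz ⟨i, s⟩)
    (hab ▸ det₂_edgePoint hz ⟨j, t⟩) (by linarith)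
  have hst := congrArg toPlane hab
  rw [toPlane_edgePoint hz, toPlane_edgePoint hz] at hst
  have hst' := smul_left_injective ℝ (D.edge_ne_zero i) (add_left_cancel hst)
  have hst_eq : s = t := Fin.ext (Nat.cast_injective hst')
  rw [hst_eq]

lemma mem_range_edgePoint_or_det₂_succ_eq (Q : IsParallelPolygon e K P k) (D : IsEdgeData Γ p e l)
    (hz : ∀ i, toPlane (z i) = P i) {v : ℤ × ℤ} (hv : toPlane v ∈ K) {i : Fin n}
    (hi : det₂ (toPlane v) (toPlane (e i)) = det₂ (P i) (toPlane (e i))) :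
    v ∈ Set.range (edgePoint z e k) ∨ det₂ (toPlane v) (toPlane (e (finRotate n i)))
      = det₂ (P (finRotate n i)) (toPlane (e (finRotate n i))) := by
  obtain ⟨t, ht₀, htk, ht⟩ := D.exists_eq_add_smul Q.step ((Q.mem_iff _).1 hv) hi
  obtain ⟨s, rfl⟩ := exists_int_of_smul_toPlane (D.isCoprime i) (z := v - z i) (t := t) (by
    rw [toPlane_sub, ht, hz, add_sub_cancel_left])
  have hs₀ : 0 ≤ s := by exact_mod_cast ht₀
  have hsk : s ≤ k i := by exact_mod_cast htk
  rcases hsk.lt_or_eq with hlt | rfl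
  · refine Or.inl ⟨⟨i, ⟨s.toNat, by omega⟩⟩, toPlane_injective ?_⟩
    rw [edgePoint, toPlane_add, toPlane_zsmul, Int.toNat_of_nonneg hs₀, ht, hz]
  · exact Or.inr (by rw [ht, ← Q.step])

lemma setOf_toPlane_mem_frontier (Q : IsParallelPolygon e K P k) (D : IsEdgeData Γ p e l)
    (hz : ∀ i, toPlane (z i) = P i) :
    {v : ℤ × ℤ | toPlane v ∈ frontier K} = Set.range (edgePoint z e k) := by
  ext v
  rw [Set.mem_ofPred_eq, mem_frontier_iff_of_det₂_le D.edge_ne_zero Q.mem_iff]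
  constructor
  · rintro ⟨hv, i, hi⟩
    by_contra hnot
    obtain ⟨j, hj⟩ := Q.exists_det₂_ne D (toPlane v)
    exact hj (finRotate_induction
      (P := fun i ↦ det₂ (toPlane v) (toPlane (e i)) = det₂ (P i) (toPlane (e i)))
      (fun i hi ↦ (Q.mem_range_edgePoint_or_det₂_succ_eq D hz hv hi).resolve_left hnot) hi j)
  · rintro ⟨a, rfl⟩
    exact ⟨Q.edgePoint_mem hz a, a.1, det₂_edgePoint hz a⟩

theorem boundaryCount_eq (Q : IsParallelPolygon e K P k) (D : IsEdgeData Γ p e l) :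
    (boundaryCount K : ℤ) = ∑ i, k i := by
  choose z hz using Q.lattice
  rw [boundaryCount, Q.setOf_toPlane_mem_frontier D hz, ← Set.image_univ,
    Set.ncard_image_of_injective _ (Q.edgePoint_injective D hz), Set.ncard_univ,
    Nat.card_eq_fintype_card, Fintype.card_sigma, Nat.cast_sum]
  refine Finset.sum_congr rfl fun i _ ↦ ?_
  rw [Fintype.card_fin, Int.toNat_of_nonneg (Q.length_nonneg D i)]

end IsParallelPolygon

end ParallelPolygons

section Facets

lemma exists_det₂_gt_of_mem_interior {K : Set (ℝ × ℝ)} {x g : ℝ × ℝ} (hx : x ∈ interior K)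
    (hg : g ≠ 0) : ∃ y ∈ K, det₂ x g < det₂ y g := by
  obtain ⟨w, hw⟩ := detLeft_surjective hg 1
  have hcont : Continuous fun t : ℝ ↦ x + t • w := by fun_prop
  have hnhds : ∀ᶠ t in nhds (0 : ℝ), x + t • w ∈ K := by
    apply hcont.continuousAt.eventually_mem
    rw [zero_smul, add_zero]
    exact mem_interior_iff_mem_nhds.1 hx
  obtain ⟨t, ht, htpos⟩ := ((hnhds.filter_mono nhdsWithin_le_nhds).and
    (self_mem_nhdsWithin (s := Set.Ioi (0 : ℝ)))).exists
  refine ⟨_, ht, ?_⟩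
  rw [detLeft_apply] at hw
  rw [det₂_add_left, det₂_smul_left, hw, mul_one]
  exact lt_add_of_pos_right _ htpos

lemma linForm_eq_det₂ (a : ℤ × ℤ) (x : ℝ × ℝ) : linForm a x = det₂ x (toPlane (-a.2, a.1)) := by
  simp only [linForm, det₂, toPlane, Int.cast_neg]
  ring

/-- The outer normal covector of an edge with direction `e` of a polygon to the left of that
edge. -/
def conormal (e : ℤ × ℤ) : ℤ × ℤ := (e.2, -e.1)

lemma linForm_conormal (e : ℤ × ℤ) (x : ℝ × ℝ) : linForm (conormal e) x = det₂ x (toPlane e) := by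
  rw [linForm_eq_det₂, conormal, neg_neg]

lemma isCoprime_conormal {e : ℤ × ℤ} (he : IsCoprime e.1 e.2) :
    IsCoprime (conormal e).1 (conormal e).2 :=
  he.symm.neg_right

variable {Γ K : Set (ℝ × ℝ)} {n : ℕ} {p P : Fin n → ℝ × ℝ} {e : Fin n → ℤ × ℤ} {l k : Fin n → ℤ}

namespace IsParallelPolygon

lemma exists_int_det₂ (Q : IsParallelPolygon e K P k) (i : Fin n) (f : ℤ × ℤ) :
    ∃ b : ℤ, det₂ (P i) (toPlane f) = b := by
  obtain ⟨z, hz⟩ := Q.lattice i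
  exact ⟨_, by rw [← hz, det₂_toPlane]⟩

lemma det₂_succ (Q : IsParallelPolygon e K P k) (i : Fin n) :
    det₂ (P (finRotate n i)) (toPlane (e i)) = det₂ (P i) (toPlane (e i)) :=
  det₂_finRotate (u := fun i ↦ toPlane (e i)) Q.step i

lemma isFacetInequality (Q : IsParallelPolygon e K P k) (D : IsEdgeData Γ p e l) {i : Fin n}
    (hi : 0 < k i) {b : ℤ} (hb : det₂ (P i) (toPlane (e i)) = b) :
    IsFacetInequality K (conormal (e i)) b := by
  refine ⟨isCoprime_conormal (D.isCoprime i), fun x hx ↦ ?_, P i, ⟨Q.vertex_mem i, ?_⟩,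
    P (finRotate n i), ⟨Q.vertex_mem _, ?_⟩, ?_⟩
  · rw [linForm_conormal, ← hb]
    exact (Q.mem_iff x).1 hx i
  · rw [linForm_conormal, ← hb]
  · rw [linForm_conormal, ← hb, Q.det₂_succ]
  · rw [Q.step, Ne, left_eq_add]
    exact smul_ne_zero (by exact_mod_cast hi.ne') (D.edge_ne_zero i)

end IsParallelPolygon

namespace IsEdgeData

lemma vertex_add_edge_mem (D : IsEdgeData Γ p e l) (i : Fin n) : p i + toPlane (e i) ∈ Γ := by
  have hone : (1 : ℝ) ≤ l i := by exact_mod_cast D.length_pos i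
  have hmem := D.isParallelPolygon.convex.add_smul_mem (D.vertex_mem i)
    (D.step i ▸ D.vertex_mem (finRotate n i)) (t := (l i : ℝ)⁻¹)
    ⟨by positivity, inv_le_one_of_one_le₀ hone⟩
  rwa [smul_smul, inv_mul_cancel₀ (D.cast_length_pos i).ne', one_smul] at hmem

lemma exists_det₂_nonneg_nonpos (D : IsEdgeData Γ p e l) (g : ℝ × ℝ) :
    ∃ i, 0 ≤ det₂ (toPlane (e i)) g ∧ det₂ (toPlane (e (finRotate n i))) g ≤ 0 := by
  obtain ⟨i, a, b, ha, hb, rfl⟩ := D.exists_normal_cone g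
  refine ⟨i, ?_, ?_⟩ <;> rw [det₂_add_right, det₂_smul_right, det₂_smul_right, det₂_self, mul_zero]
  · rw [zero_add]
    exact mul_nonneg hb (D.turn i).le
  · rw [add_zero, det₂_swap, mul_neg, neg_nonpos]
    exact mul_nonneg ha (D.turn i).le

lemma det₂_le_det₂_vertex (D : IsEdgeData Γ p e l) {i : Fin n} {g x : ℝ × ℝ}
    (hpos : 0 ≤ det₂ (toPlane (e i)) g) (hneg : det₂ (toPlane (e (finRotate n i))) g ≤ 0)
    (hx : x ∈ Γ) : det₂ x g ≤ det₂ (p (finRotate n i)) g := by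
  have hcomb (y : ℝ × ℝ) := congrArg (det₂ y)
    (det₂_smul_eq (toPlane (e i)) (toPlane (e (finRotate n i))) g)
  simp only [det₂_add_right, det₂_smul_right] at hcomb
  rw [det₂_swap, neg_nonpos] at hneg
  refine le_of_mul_le_mul_left ?_ (D.turn i)
  rw [hcomb, hcomb, D.det₂_succ]
  gcongr
  · exact D.left i x hx
  · exact D.left _ x hx

lemma exists_edge_eq_of_isCoprime (D : IsEdgeData Γ p e l) {f : ℤ × ℤ} (hf : IsCoprime f.1 f.2)
    {b : ℝ} (hle : ∀ x ∈ Γ, det₂ x (toPlane f) ≤ b)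
    (htight : {x ∈ Γ | det₂ x (toPlane f) = b}.Nontrivial) :
    ∃ i, f = e i ∧ det₂ (p i) (toPlane (e i)) = b := by
  obtain ⟨i, hpos, hneg⟩ := D.exists_det₂_nonneg_nonpos (toPlane f)
  obtain ⟨x, ⟨hx, hxb⟩, y, ⟨hy, hyb⟩, hxy⟩ := htight
  have hb : det₂ (p (finRotate n i)) (toPlane f) = b :=
    (hle _ (D.vertex_mem _)).antisymm (hxb ▸ D.det₂_le_det₂_vertex hpos hneg hx)
  have hturn := D.turn i
  rcases hpos.eq_or_lt with hzero | hpos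
  · rw [det₂_toPlane, eq_comm, Int.cast_eq_zero] at hzero
    rcases eq_or_eq_neg_of_isCoprime (D.isCoprime i) hf hzero with rfl | rfl
    · exact ⟨i, rfl, by rw [← D.det₂_succ, hb]⟩
    · rw [toPlane_neg, ← neg_one_smul ℝ, det₂_smul_right, det₂_swap] at hneg
      linarith
  rcases hneg.eq_or_lt with hzero | hneg
  · rw [det₂_toPlane, Int.cast_eq_zero] at hzero
    rcases eq_or_eq_neg_of_isCoprime (D.isCoprime _) hf hzero with rfl | rfl
    · exact ⟨_, rfl, hb⟩
    · rw [toPlane_neg, ← neg_one_smul ℝ, det₂_smul_right] at hpos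
      linarith
  · exact absurd ((D.eq_vertex hpos hneg hx (hb.trans hxb.symm).le).trans
      (D.eq_vertex hpos hneg hy (hb.trans hyb.symm).le).symm) hxy

lemma exists_of_isFacetInequality (D : IsEdgeData Γ p e l) {a : ℤ × ℤ} {b : ℤ}
    (h : IsFacetInequality Γ a b) :
    ∃ i, a = conormal (e i) ∧ det₂ (p i) (toPlane (e i)) = b := by
  obtain ⟨hcoprime, hle, htight⟩ := h
  simp only [linForm_eq_det₂] at hle htight
  obtain ⟨i, hi, hb⟩ := D.exists_edge_eq_of_isCoprime (f := (-a.2, a.1)) hcoprime.symm.neg_left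
    hle htight
  exact ⟨i, by rw [← hi, conormal, neg_neg], hb⟩

lemma det₂_sub_eq_one_of_isRelaxedVertex (D : IsEdgeData Γ p e l) {x x' : ℝ × ℝ}
    (h : IsRelaxedVertex Γ x x') {i : Fin n}
    (hi : det₂ x (toPlane (e i)) = det₂ (p i) (toPlane (e i))) :
    det₂ (x' - x) (toPlane (e i)) = 1 := by
  obtain ⟨b, hb⟩ := D.isParallelPolygon.exists_int_det₂ i (e i)
  have hx' := h _ _ (D.isParallelPolygon.isFacetInequality D (D.length_pos i) hb)
    (by rw [linForm_conormal, hi, hb])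
  rw [linForm_conormal] at hx'
  rw [det₂_sub_left, hx', hi, hb, add_sub_cancel_left]

lemma eq_or_finRotate_eq_of_det₂_vertex_eq (D : IsEdgeData Γ p e l) {i j : Fin n}
    (h : det₂ (p (finRotate n i)) (toPlane (e j)) = det₂ (p j) (toPlane (e j))) :
    i = j ∨ finRotate n i = j := by
  have hprev : 0 ≤ det₂ (toPlane (e i)) (toPlane (e j)) := by
    have hle := D.left j _ (D.vertex_mem i)
    rw [← h, D.step, det₂_add_left, det₂_smul_left] at hle
    exact nonneg_of_mul_nonneg_right (by linarith) (D.cast_length_pos i)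
  have hnext : det₂ (toPlane (e (finRotate n i))) (toPlane (e j)) ≤ 0 := by
    have hle := D.left j _ (D.vertex_mem (finRotate n (finRotate n i)))
    rw [← h, D.step, det₂_add_left, det₂_smul_left] at hle
    exact nonpos_of_mul_nonpos_right (by linarith) (D.cast_length_pos (finRotate n i))
  rcases hprev.eq_or_lt with hzero | hpos
  · exact Or.inl (D.isParallelPolygon.eq_of_det₂_eq_zero D (D.det₂_succ i) h hzero.symm)
  · exact Or.inr (D.isParallelPolygon.eq_of_det₂_eq_zero D rfl h
      (hnext.antisymm (D.det₂_succ_nonneg_of_det₂_pos hpos)))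

lemma isRelaxedVertex_iff (D : IsEdgeData Γ p e l) (i : Fin n) (p' : ℝ × ℝ) :
    IsRelaxedVertex Γ (p (finRotate n i)) p' ↔
      det₂ (p' - p (finRotate n i)) (toPlane (e i)) = 1 ∧
      det₂ (p' - p (finRotate n i)) (toPlane (e (finRotate n i))) = 1 := by
  constructor
  · exact fun h ↦ ⟨D.det₂_sub_eq_one_of_isRelaxedVertex h (D.det₂_succ i),
      D.det₂_sub_eq_one_of_isRelaxedVertex h rfl⟩
  · rintro ⟨hprev, hnext⟩ a b hab hpb
    obtain ⟨j, rfl, hb⟩ := D.exists_of_isFacetInequality hab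
    rw [linForm_conormal] at hpb ⊢
    rcases D.eq_or_finRotate_eq_of_det₂_vertex_eq (hpb.trans hb.symm) with rfl | rfl
    · rw [det₂_sub_left, hpb] at hprev
      linarith
    · rw [det₂_sub_left, hpb] at hnext
      linarith

end IsEdgeData

end Facets

section InteriorPolygon

/-- The polygon obtained from a polygon with vertices `p i` and edge directions `e i` by moving
every edge outwards by lattice distance one. -/
def relaxedPolygon {n : ℕ} (p : Fin n → ℝ × ℝ) (e : Fin n → ℤ × ℤ) : Set (ℝ × ℝ) :=
  {x | ∀ i, det₂ x (toPlane (e i)) ≤ det₂ (p i) (toPlane (e i)) + 1}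

variable {Δ : Set (ℝ × ℝ)} {n : ℕ} {p : Fin n → ℝ × ℝ} {e : Fin n → ℤ × ℤ} {l : Fin n → ℤ}

lemma IsLatticePolytope.convex (hΔ : IsLatticePolytope Δ) : Convex ℝ Δ := by
  obtain ⟨S, rfl⟩ := hΔ
  exact convex_convexHull ℝ _

lemma interiorPolytope_subset_interior (hΔ : Convex ℝ Δ) :
    interiorPolytope Δ ⊆ interior Δ :=
  convexHull_min (Set.image_subset_iff.2 fun _ hz ↦ hz) hΔ.interior

lemma toPlane_mem_interiorPolytope_iff (hΔ : Convex ℝ Δ) {z : ℤ × ℤ} :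
    toPlane z ∈ interiorPolytope Δ ↔ toPlane z ∈ interior Δ :=
  ⟨fun hz ↦ interiorPolytope_subset_interior hΔ hz, fun hz ↦ subset_convexHull ℝ _ ⟨z, hz, rfl⟩⟩

lemma exists_int_mul_eq_add_mul {h : ℤ} (hh : 1 < h) (k : ℤ) :
    ∃ (m : ℤ) (s : ℝ), s ∈ Set.Icc 0 1 ∧ (m : ℝ) * h = k + s * (h - 1) := by
  have hpos : (0 : ℝ) < h - 1 := sub_pos.2 (by exact_mod_cast hh)
  refine ⟨-(-k / h), ((-k % h : ℤ) : ℝ) / (h - 1),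
    ⟨div_nonneg (by exact_mod_cast Int.emod_nonneg _ (by omega)) hpos.le, ?_⟩, ?_⟩
  · rw [div_le_one hpos, le_sub_iff_add_le]
    exact_mod_cast Int.emod_lt_of_pos (-k) (by omega)
  · rw [div_mul_cancel₀ _ hpos.ne']
    have hdiv := Int.mul_ediv_add_emod (-k) h
    have hcast : ((h * (-k / h) + -k % h : ℤ) : ℝ) = ((-k : ℤ) : ℝ) := by rw [hdiv]
    push_cast at hcast ⊢
    linarith

lemma exists_det_eq_one {e : ℤ × ℤ} (he : IsCoprime e.1 e.2) :
    ∃ u : ℤ × ℤ, u.1 * e.2 - u.2 * e.1 = 1 := by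
  obtain ⟨a, b, h⟩ := he
  exact ⟨(b, -a), by simp only; linear_combination h⟩

/-- The interior of the triangle spanned by an interior lattice segment and a lattice point at
height `h > 1` over it contains a lattice point at height one: a segment of length `(h - 1) / h`
at height one always contains one when its ends have denominator `h`. -/
lemma exists_mem_interior_det₂_eq_add_one (hΔ : Convex ℝ Δ) {a z e : ℤ × ℤ}
    (he : IsCoprime e.1 e.2) (ha : toPlane a ∈ interior Δ) (hae : toPlane (a + e) ∈ interior Δ)
    (hz : toPlane z ∈ Δ) (hlt : a.1 * e.2 - a.2 * e.1 + 1 < z.1 * e.2 - z.2 * e.1) :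
    ∃ y, toPlane y ∈ interior Δ ∧ det₂ (toPlane y) (toPlane e)
      = det₂ (toPlane a) (toPlane e) + 1 := by
  obtain ⟨u, hu⟩ := exists_det_eq_one he
  obtain ⟨h, hh⟩ : ∃ h, h = (z.1 * e.2 - z.2 * e.1) - (a.1 * e.2 - a.2 * e.1) := ⟨_, rfl⟩
  obtain ⟨k, hk⟩ := exists_eq_smul_of_isCoprime he (f := z - a - h • u) (by
    simp only [Prod.fst_sub, Prod.snd_sub, Prod.smul_fst, Prod.smul_snd, smul_eq_mul]
    linear_combination h * hu + hh)
  have hone : 1 < h := by omega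
  have hpos : (0 : ℝ) < h := by exact_mod_cast one_pos.trans hone
  obtain ⟨m, s, hs, hm⟩ := exists_int_mul_eq_add_mul hone k
  have hbase : toPlane a + s • toPlane e ∈ interior Δ := by
    rw [toPlane_add] at hae
    exact hΔ.interior.add_smul_mem ha hae hs
  refine ⟨a + u + m • e, ?_, ?_⟩
  · have hmem := hΔ.combo_interior_self_mem_interior hbase hz (a := 1 - 1 / h) (b := 1 / h)
      (by rw [sub_pos, div_lt_one hpos]; exact_mod_cast hone) (by positivity) (sub_add_cancel _ _)
    convert hmem using 1
    have hz_eq : z = a + h • u + k • e := by rw [← hk]; abel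
    have hm_eq : (m : ℝ) = (1 - 1 / h) * s + k / h := by
      field_simp
      linear_combination hm
    rw [hz_eq]
    simp only [toPlane_add, toPlane_zsmul, hm_eq]
    match_scalars <;> field_simp
    ring
  · rw [toPlane_add, toPlane_add, toPlane_zsmul, det₂_add_left, det₂_add_left, det₂_smul_left,
      det₂_self, det₂_toPlane u, hu, mul_zero, add_zero, Int.cast_one]

theorem subset_relaxedPolygon (hΔ : IsLatticePolytope Δ)
    (D : IsEdgeData (interiorPolytope Δ) p e l) : Δ ⊆ relaxedPolygon p e := by
  intro x hx i
  have hconv := hΔ.convex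
  obtain ⟨S, rfl⟩ := hΔ
  refine det₂_le_of_mem_convexHull ?_ hx
  rintro _ ⟨z, hz, rfl⟩
  obtain ⟨a, ha⟩ := D.lattice i
  by_contra! hlt
  rw [← ha, det₂_toPlane, det₂_toPlane] at hlt
  have hsucc := D.vertex_add_edge_mem i
  rw [← ha, ← toPlane_add] at hsucc
  obtain ⟨y, hy, hheight⟩ := exists_mem_interior_det₂_eq_add_one hconv (D.isCoprime i)
    (interiorPolytope_subset_interior hconv (ha ▸ D.vertex_mem i))
    (interiorPolytope_subset_interior hconv hsucc) (subset_convexHull ℝ _ ⟨z, hz, rfl⟩)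
    (by exact_mod_cast hlt)
  have hle := D.left i _ ((toPlane_mem_interiorPolytope_iff hconv).2 hy)
  rw [hheight, ha] at hle
  linarith

end InteriorPolygon

section Relaxation

/-- Two dual loops: the moves of `q` go from `q i` along `e i` and have length `L i`, and `q i` is
at height one over `e i`; the dual moves go from `e i` to `e (i + 1)` and have length `d i`. -/
structure IsDualLoopPair {n : ℕ} (q e : Fin n → ℤ × ℤ) (L d : Fin n → ℤ) : Prop where
  height : ∀ i, (q i).1 * (e i).2 - (q i).2 * (e i).1 = 1
  move : ∀ i, q (finRotate n i) = q i + L i • e i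
  dual_move : ∀ i, e (finRotate n i) = e i - d i • q (finRotate n i)
  dual_pos : ∀ i, 0 < d i

namespace IsDualLoopPair

variable {n : ℕ} {q e : Fin n → ℤ × ℤ} {L d : Fin n → ℤ}

lemma det₂_height (R : IsDualLoopPair q e L d) (i : Fin n) :
    det₂ (toPlane (q i)) (toPlane (e i)) = 1 := by
  rw [det₂_toPlane, R.height, Int.cast_one]

lemma det₂_add_smul (R : IsDualLoopPair q e L d) (s : ℤ) (i : Fin n) :
    det₂ (toPlane (q i + s • e i)) (toPlane (e i)) = 1 := by
  rw [toPlane_add, toPlane_zsmul, det₂_add_left, det₂_smul_left, det₂_self, R.det₂_height,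
    mul_zero, add_zero]

lemma det₂_height_succ (R : IsDualLoopPair q e L d) (i : Fin n) :
    det₂ (toPlane (q (finRotate n i))) (toPlane (e i)) = 1 := by
  rw [R.move, R.det₂_add_smul]

lemma det₂_add (R : IsDualLoopPair q e L d) (x : ℝ × ℝ) (i : Fin n) :
    det₂ (x + toPlane (q i)) (toPlane (e i)) = det₂ x (toPlane (e i)) + 1 := by
  rw [det₂_add_left, R.det₂_height]

lemma det₂_dual (R : IsDualLoopPair q e L d) (i : Fin n) :
    det₂ (toPlane (e i)) (toPlane (e (finRotate n i))) = d i := by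
  rw [R.dual_move, toPlane_sub, toPlane_zsmul, det₂_sub_right, det₂_smul_right, det₂_self,
    det₂_swap, R.det₂_height_succ]
  ring

end IsDualLoopPair

lemma eq_sub_smul_of_det_eq_one {q e f : ℤ × ℤ} (he : q.1 * e.2 - q.2 * e.1 = 1)
    (hf : q.1 * f.2 - q.2 * f.1 = 1) : f = e - (e.1 * f.2 - e.2 * f.1) • q := by
  ext
  · simp only [Prod.fst_sub, Prod.smul_fst, smul_eq_mul]
    linear_combination e.1 * hf - f.1 * he
  · simp only [Prod.snd_sub, Prod.smul_snd, smul_eq_mul]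
    linear_combination e.2 * hf - f.2 * he

lemma exists_eq_add_smul_of_det_eq_one {q r e : ℤ × ℤ} (he : IsCoprime e.1 e.2)
    (hq : q.1 * e.2 - q.2 * e.1 = 1) (hr : r.1 * e.2 - r.2 * e.1 = 1) : ∃ L : ℤ, r = q + L • e := by
  obtain ⟨L, hL⟩ := exists_eq_smul_of_isCoprime he (f := r - q) (by
    simp only [Prod.fst_sub, Prod.snd_sub]
    linear_combination hq - hr)
  exact ⟨L, by rw [← hL, add_sub_cancel]⟩

lemma exists_det_eq_one_of_det_eq_zero {f g x : ℤ × ℤ} (hg : IsCoprime g.1 g.2)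
    (hf : x.1 * f.2 - x.2 * f.1 = 1) (hxg : x.1 * g.2 - x.2 * g.1 = 0) :
    ∃ q : ℤ × ℤ, q.1 * f.2 - q.2 * f.1 = 1 ∧ q.1 * g.2 - q.2 * g.1 = 1 := by
  obtain ⟨u, hu⟩ := exists_det_eq_one hg
  refine ⟨u + (1 - (u.1 * f.2 - u.2 * f.1)) • x, ?_, ?_⟩ <;>
    simp only [Prod.fst_add, Prod.snd_add, Prod.smul_fst, Prod.smul_snd, smul_eq_mul]
  · linear_combination (1 - (u.1 * f.2 - u.2 * f.1)) * hf
  · linear_combination hu + (1 - (u.1 * f.2 - u.2 * f.1)) * hxg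

lemma exists_det_eq_one_of_det_le_one {f g x : ℤ × ℤ} (hf : IsCoprime f.1 f.2)
    (hg : IsCoprime g.1 g.2) (hxf : x.1 * f.2 - x.2 * f.1 ≤ 1) (hxg : x.1 * g.2 - x.2 * g.1 ≤ 1)
    (hpos : 0 < (x.1 * f.2 - x.2 * f.1) + (x.1 * g.2 - x.2 * g.1)) :
    ∃ q : ℤ × ℤ, q.1 * f.2 - q.2 * f.1 = 1 ∧ q.1 * g.2 - q.2 * g.1 = 1 := by
  rcases hxf.lt_or_eq with hlt | hxf
  · obtain ⟨q, hqg, hqf⟩ := exists_det_eq_one_of_det_eq_zero (f := g) (x := x) hf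
      (by omega) (by omega)
    exact ⟨q, hqf, hqg⟩
  rcases hxg.lt_or_eq with hlt | hxg
  · exact exists_det_eq_one_of_det_eq_zero hg hxf (by omega)
  · exact ⟨x, hxf, hxg⟩

variable {Γ Δ K : Set (ℝ × ℝ)} {n : ℕ} {p P : Fin n → ℝ × ℝ} {q e : Fin n → ℤ × ℤ}
  {l k L d : Fin n → ℤ}

lemma IsLatticePolytope.exists_toPlane_mem_det₂_gt (hΔ : IsLatticePolytope Δ) {x g : ℝ × ℝ}
    (hx : x ∈ interior Δ) (hg : g ≠ 0) :
    ∃ z, toPlane z ∈ Δ ∧ det₂ x g < det₂ (toPlane z) g := by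
  obtain ⟨S, rfl⟩ := hΔ
  obtain ⟨y, hy, hlt⟩ := exists_det₂_gt_of_mem_interior hx hg
  by_contra! hle
  exact hlt.not_ge (det₂_le_of_mem_convexHull
    (by rintro _ ⟨z, hz, rfl⟩; exact hle z (subset_convexHull ℝ _ ⟨z, hz, rfl⟩)) hy)

namespace IsEdgeData

lemma exists_toPlane_mem_det₂_eq_add_one (hΔ : IsLatticePolytope Δ)
    (D : IsEdgeData (interiorPolytope Δ) p e l) (i : Fin n) :
    ∃ z, toPlane z ∈ Δ ∧ det₂ (toPlane z) (toPlane (e i)) = det₂ (p i) (toPlane (e i)) + 1 := by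
  obtain ⟨z, hz, hlt⟩ := hΔ.exists_toPlane_mem_det₂_gt
    (interiorPolytope_subset_interior hΔ.convex (D.vertex_mem i)) (D.edge_ne_zero i)
  refine ⟨z, hz, (subset_relaxedPolygon hΔ D hz i).antisymm ?_⟩
  obtain ⟨a, ha⟩ := D.lattice i
  rw [← ha, det₂_toPlane, det₂_toPlane] at hlt ⊢
  exact_mod_cast hlt

lemma edge_add_edge_succ_ne_zero (D : IsEdgeData Γ p e l) (i : Fin n) :
    toPlane (e i + e (finRotate n i)) ≠ 0 := by
  intro hzero
  have hturn := D.turn i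
  rw [toPlane_add] at hzero
  rw [eq_neg_of_add_eq_zero_right hzero, ← neg_one_smul ℝ, det₂_smul_right, det₂_self,
    mul_zero] at hturn
  exact lt_irrefl _ hturn

/-- Some lattice point of `Δ` lies beyond the vertex and within the relaxed cone at it, which forces
the apex of that cone to be a lattice point. -/
lemma exists_det_eq_one_succ (hΔ : IsLatticePolytope Δ)
    (D : IsEdgeData (interiorPolytope Δ) p e l) (i : Fin n) :
    ∃ q : ℤ × ℤ, q.1 * (e i).2 - q.2 * (e i).1 = 1 ∧
      q.1 * (e (finRotate n i)).2 - q.2 * (e (finRotate n i)).1 = 1 := by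
  obtain ⟨z, hz, hlt⟩ := hΔ.exists_toPlane_mem_det₂_gt
    (interiorPolytope_subset_interior hΔ.convex (D.vertex_mem (finRotate n i)))
    (D.edge_add_edge_succ_ne_zero i)
  have hprev := subset_relaxedPolygon hΔ D hz i
  have hnext := subset_relaxedPolygon hΔ D hz (finRotate n i)
  obtain ⟨a, ha⟩ := D.lattice (finRotate n i)
  rw [← D.det₂_succ] at hprev
  simp only [← ha, det₂_toPlane] at hprev hnext hlt
  norm_cast at hprev hnext hlt
  refine exists_det_eq_one_of_det_le_one (x := z - a) (D.isCoprime _) (D.isCoprime _) ?_ ?_ ?_ <;>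
    simp only [Prod.fst_add, Prod.snd_add, Prod.fst_sub, Prod.snd_sub] at hlt ⊢ <;> linarith

lemma exists_isDualLoopPair_of_forall_det_eq_one (D : IsEdgeData Γ p e l)
    (hq : ∀ i, (q i).1 * (e i).2 - (q i).2 * (e i).1 = 1)
    (hq_succ : ∀ i, (q (finRotate n i)).1 * (e i).2 - (q (finRotate n i)).2 * (e i).1 = 1) :
    ∃ L d, IsDualLoopPair q e L d := by
  choose L hL using fun i ↦ exists_eq_add_smul_of_det_eq_one (D.isCoprime i) (hq i) (hq_succ i)
  refine ⟨L, _, hq, hL, fun i ↦ eq_sub_smul_of_det_eq_one (hq_succ i) (hq _), fun i ↦ ?_⟩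
  have hturn := D.turn i
  rw [det₂_toPlane] at hturn
  exact_mod_cast hturn

lemma exists_isDualLoopPair (hΔ : IsLatticePolytope Δ)
    (D : IsEdgeData (interiorPolytope Δ) p e l) : ∃ q L d, IsDualLoopPair q e L d := by
  choose r hprev hnext using exists_det_eq_one_succ hΔ D
  have hr (i : Fin n) : r ((finRotate n).symm (finRotate n i)) = r i := by
    rw [Equiv.symm_apply_apply]
  refine ⟨fun i ↦ r ((finRotate n).symm i), D.exists_isDualLoopPair_of_forall_det_eq_one
    (fun i ↦ ?_) (fun i ↦ by simpa only [hr] using hprev i)⟩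
  obtain ⟨i, rfl⟩ := (finRotate n).surjective i
  simpa only [hr] using hnext i

lemma relaxed_step (D : IsEdgeData Γ p e l) (R : IsDualLoopPair q e L d) (i : Fin n) :
    p (finRotate n i) + toPlane (q (finRotate n i))
      = p i + toPlane (q i) + ((l i + L i : ℤ) : ℝ) • toPlane (e i) := by
  rw [D.step, R.move, toPlane_add, toPlane_zsmul]
  push_cast
  module

lemma exists_mem_relaxed_edge (hΔ : IsLatticePolytope Δ)
    (D : IsEdgeData (interiorPolytope Δ) p e l) (R : IsDualLoopPair q e L d) (i : Fin n) :
    ∃ t : ℝ, 0 ≤ t ∧ t ≤ (l i + L i : ℤ) ∧ p i + toPlane (q i) + t • toPlane (e i) ∈ Δ := by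
  obtain ⟨z, hz, hzi⟩ := exists_toPlane_mem_det₂_eq_add_one hΔ D i
  obtain ⟨t, ht₀, ht, hzt⟩ := D.exists_eq_add_smul (P := fun i ↦ p i + toPlane (q i))
    (D.relaxed_step R) (fun j ↦ (subset_relaxedPolygon hΔ D hz j).trans_eq (R.det₂_add _ _).symm)
    (hzi.trans (R.det₂_add _ _).symm)
  exact ⟨t, ht₀, ht, hzt ▸ hz⟩

lemma relaxed_vertex_mem (hΔ : IsLatticePolytope Δ) (D : IsEdgeData (interiorPolytope Δ) p e l)
    (R : IsDualLoopPair q e L d) (i : Fin n) : p i + toPlane (q i) ∈ relaxedPolygon p e := by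
  intro j
  obtain ⟨i, rfl⟩ := (finRotate n).surjective i
  rcases le_or_gt (det₂ (toPlane (e i)) (toPlane (e j))) 0 with hle | hpos
  · obtain ⟨t, -, ht, hmem⟩ := exists_mem_relaxed_edge hΔ D R i
    have hbound := subset_relaxedPolygon hΔ D hmem j
    rw [D.relaxed_step R, det₂_add_left, det₂_smul_left]
    rw [det₂_add_left, det₂_smul_left] at hbound
    linarith [mul_nonneg_of_nonpos_of_nonpos (sub_nonpos.2 ht) hle]
  · obtain ⟨t, ht, -, hmem⟩ := exists_mem_relaxed_edge hΔ D R (finRotate n i)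
    have hbound := subset_relaxedPolygon hΔ D hmem j
    rw [det₂_add_left, det₂_smul_left] at hbound
    linarith [mul_nonneg ht (D.det₂_succ_nonneg_of_det₂_pos hpos)]

lemma isParallelPolygon_relaxedPolygon (hΔ : IsLatticePolytope Δ)
    (D : IsEdgeData (interiorPolytope Δ) p e l) (R : IsDualLoopPair q e L d) :
    IsParallelPolygon e (relaxedPolygon p e) (fun i ↦ p i + toPlane (q i))
      (fun i ↦ l i + L i) where
  lattice i := by
    obtain ⟨a, ha⟩ := D.lattice i
    exact ⟨a + q i, by rw [toPlane_add, ha]⟩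
  step := D.relaxed_step R
  mem_iff x := by simp only [R.det₂_add, relaxedPolygon, Set.mem_ofPred_eq]
  vertex_mem := relaxed_vertex_mem hΔ D R
  exists_lt := by
    obtain ⟨y, hy⟩ := D.exists_forall_det₂_lt
    exact ⟨y, fun i ↦ by rw [R.det₂_add]; exact (hy i).trans (lt_add_one _)⟩

end IsEdgeData

lemma IsParallelPolygon.isLatticePolytope (Q : IsParallelPolygon e K P k)
    (D : IsEdgeData Γ p e l) : IsLatticePolytope K := by
  classical
  choose z hz using Q.lattice
  refine ⟨Finset.univ.image z, ?_⟩
  have hvertices : toPlane '' (Finset.univ.image z : Finset (ℤ × ℤ)) = Set.range P := by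
    rw [Finset.coe_image, Finset.coe_univ, Set.image_univ, ← Set.range_comp]
    exact congrArg Set.range (funext hz)
  rw [hvertices]
  exact Set.Subset.antisymm
    (fun x hx ↦ D.mem_convexHull_of_det₂_le Q.step ((Q.mem_iff x).1 hx))
    (convexHull_min (Set.range_subset_iff.2 Q.vertex_mem) Q.convex)

namespace IsEdgeData

lemma toPlane_mem_of_mem_interior_relaxedPolygon (D : IsEdgeData Γ p e l) {z : ℤ × ℤ}
    (hz : toPlane z ∈ interior (relaxedPolygon p e)) : toPlane z ∈ Γ := by
  rw [D.mem_iff]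
  intro i
  obtain ⟨x, hx, hlt⟩ := exists_det₂_gt_of_mem_interior hz (D.edge_ne_zero i)
  have hlt' := hlt.trans_le (hx i)
  obtain ⟨a, ha⟩ := D.lattice i
  rw [← ha, det₂_toPlane, det₂_toPlane] at hlt' ⊢
  norm_cast at hlt' ⊢
  exact Int.lt_add_one_iff.1 hlt'

theorem eq_relaxedPolygon_of_isMaximal (hΔ : IsLatticePolytope Δ) (hmax : IsMaximalPolytope Δ)
    (D : IsEdgeData (interiorPolytope Δ) p e l) (R : IsDualLoopPair q e L d) :
    Δ = relaxedPolygon p e := by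
  have hsub : Δ ⊆ relaxedPolygon p e := subset_relaxedPolygon hΔ D
  by_contra hne
  refine hmax _ ((isParallelPolygon_relaxedPolygon hΔ D R).isLatticePolytope D)
    (hsub.ssubset_of_ne hne) (Set.Subset.antisymm (fun z hz ↦ ?_) fun z hz ↦ interior_mono hsub hz)
  exact interiorPolytope_subset_interior hΔ.convex
    (D.toPlane_mem_of_mem_interior_relaxedPolygon hz)

theorem isParallelPolygon_of_isMaximal (hΔ : IsLatticePolytope Δ) (hmax : IsMaximalPolytope Δ)
    (D : IsEdgeData (interiorPolytope Δ) p e l) (R : IsDualLoopPair q e L d) :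
    IsParallelPolygon e Δ (fun i ↦ p i + toPlane (q i)) (fun i ↦ l i + L i) := by
  have hrelaxed := isParallelPolygon_relaxedPolygon hΔ D R
  rwa [← eq_relaxedPolygon_of_isMaximal hΔ hmax D R] at hrelaxed

theorem boundaryCount_sub_eq_sum (hΔ : IsLatticePolytope Δ) (hmax : IsMaximalPolytope Δ)
    (D : IsEdgeData (interiorPolytope Δ) p e l) (R : IsDualLoopPair q e L d) :
    (boundaryCount Δ : ℤ) - boundaryCount (interiorPolytope Δ) = ∑ i, L i := by
  rw [(isParallelPolygon_of_isMaximal hΔ hmax D R).boundaryCount_eq D,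
    D.isParallelPolygon.boundaryCount_eq D, Finset.sum_add_distrib, add_sub_cancel_left]

end IsEdgeData

end Relaxation

section NumberTwelve

variable {Γ : Set (ℝ × ℝ)} {n : ℕ} {p : Fin n → ℝ × ℝ} {q e : Fin n → ℤ × ℤ} {l L d : Fin n → ℤ}

namespace IsEdgeData

lemma sum_mul_snd_eq_zero (D : IsEdgeData Γ p e l) : ∑ i, l i * (e i).2 = 0 := by
  have hsum := D.sum_mul_det₂_eq_zero (1, 0)
  simp only [det₂, toPlane, one_mul, zero_mul, sub_zero] at hsum
  exact_mod_cast hsum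

lemma exists_snd_neg (D : IsEdgeData Γ p e l) : ∃ i, (e i).2 < 0 := by
  by_contra! hnonneg
  have hzero : ∀ i, (e i).2 = 0 := fun i ↦ (mul_eq_zero.1
    ((Finset.sum_eq_zero_iff_of_nonneg fun i _ ↦ mul_nonneg (D.length_pos i).le (hnonneg i)).1
      D.sum_mul_snd_eq_zero i (Finset.mem_univ i))).resolve_left (D.length_pos i).ne'
  have hturn := D.turn ⟨0, D.pos⟩
  rw [det₂_toPlane, hzero, hzero, mul_zero, zero_mul, sub_zero, Int.cast_zero] at hturn
  exact lt_irrefl _ hturn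

lemma exists_snd_nonneg (D : IsEdgeData Γ p e l) : ∃ i, 0 ≤ (e i).2 := by
  by_contra! hneg
  exact (Finset.sum_neg (fun i _ ↦ mul_neg_of_pos_of_neg (D.length_pos i) (hneg i))
    ⟨⟨0, D.pos⟩, Finset.mem_univ _⟩).ne D.sum_mul_snd_eq_zero

lemma exists_snd_nonneg_snd_succ_neg (D : IsEdgeData Γ p e l) :
    ∃ i, 0 ≤ (e i).2 ∧ (e (finRotate n i)).2 < 0 := by
  by_contra! hnonneg
  obtain ⟨i, hi⟩ := D.exists_snd_nonneg
  obtain ⟨j, hj⟩ := D.exists_snd_neg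
  exact (finRotate_induction (P := fun i ↦ 0 ≤ (e i).2) hnonneg hi j).not_gt hj

lemma snd_le_of_snd_nonneg_of_snd_succ_neg (D : IsEdgeData Γ p e l) {i : Fin n}
    (hi : 0 ≤ (e i).2) (hi_succ : (e (finRotate n i)).2 < 0) {x : ℝ × ℝ} (hx : x ∈ Γ) :
    x.2 ≤ (p (finRotate n i)).2 := by
  have hdet (x : ℝ × ℝ) : det₂ x (-1, 0) = x.2 := by simp only [det₂]; ring
  have hle := D.det₂_le_det₂_vertex (i := i) (g := (-1, 0))
    (by rw [hdet]; exact Int.cast_nonneg hi) (by rw [hdet]; exact Int.cast_nonpos.2 hi_succ.le) hx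
  rwa [hdet, hdet] at hle

lemma fst_le_of_snd_succ_neg (D : IsEdgeData Γ p e l) {i : Fin n}
    (hi_succ : (e (finRotate n i)).2 < 0) {x : ℝ × ℝ} (hx : x ∈ Γ)
    (hsnd : x.2 = (p (finRotate n i)).2) : (p (finRotate n i)).1 ≤ x.1 := by
  have hle := (D.mem_iff x).1 hx (finRotate n i)
  simp only [det₂, toPlane, hsnd] at hle
  have hneg : ((e (finRotate n i)).2 : ℝ) < 0 := Int.cast_lt_zero.2 hi_succ
  exact (mul_le_mul_right_of_neg hneg).1 (by linarith)

lemma eq_of_snd_nonneg_of_snd_succ_neg (D : IsEdgeData Γ p e l) {i j : Fin n}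
    (hi : 0 ≤ (e i).2) (hi_succ : (e (finRotate n i)).2 < 0)
    (hj : 0 ≤ (e j).2) (hj_succ : (e (finRotate n j)).2 < 0) : i = j := by
  have hsnd := (D.snd_le_of_snd_nonneg_of_snd_succ_neg hj hj_succ
    (D.vertex_mem (finRotate n i))).antisymm
    (D.snd_le_of_snd_nonneg_of_snd_succ_neg hi hi_succ (D.vertex_mem (finRotate n j)))
  have hfst := (D.fst_le_of_snd_succ_neg hi_succ (D.vertex_mem _) hsnd.symm).antisymm
    (D.fst_le_of_snd_succ_neg hj_succ (D.vertex_mem _) hsnd)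
  exact (finRotate n).injective (D.injective (Prod.ext hfst hsnd))

/-- The counted index is that of the highest vertex, the leftmost one if there are two. -/
lemma sum_crossings_eq_one (D : IsEdgeData Γ p e l) :
    ∑ i, (if 0 ≤ (e i).2 ∧ (e (finRotate n i)).2 < 0 then 1 else 0 : ℤ) = 1 := by
  obtain ⟨i, hi, hi_succ⟩ := D.exists_snd_nonneg_snd_succ_neg
  rw [Finset.sum_eq_single_of_mem i (Finset.mem_univ i), if_pos ⟨hi, hi_succ⟩]
  exact fun j _ hji ↦ if_neg fun ⟨hj, hj_succ⟩ ↦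
    hji (D.eq_of_snd_nonneg_of_snd_succ_neg hj hj_succ hi hi_succ)

theorem sum_add_sum_eq_twelve (D : IsEdgeData Γ p e l) (R : IsDualLoopPair q e L d) :
    ∑ i, L i + ∑ i, d i = 12 := by
  rw [sum_add_sum_eq_twelve_mul_crossings (finRotate n) e q L d R.height R.move R.dual_move
    fun i ↦ (R.dual_pos i).le, D.sum_crossings_eq_one, mul_one]

end IsEdgeData

end NumberTwelve

section ColumnVectors

variable {Γ Δ K : Set (ℝ × ℝ)} {n : ℕ} {p P : Fin n → ℝ × ℝ} {q e : Fin n → ℤ × ℤ}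
  {l k L d : Fin n → ℤ}

lemma det₂_mul_det₂ (a b u v : ℝ × ℝ) :
    det₂ a b * det₂ u v = det₂ u b * det₂ a v - det₂ u a * det₂ b v := by
  simp only [det₂]
  ring

namespace IsDualLoopPair

lemma det₂_add_smul_succ_nonpos (R : IsDualLoopPair q e L d) {i : Fin n} {s : ℤ} (hs : 1 ≤ s) :
    det₂ (toPlane (q (finRotate n i) + s • e (finRotate n i))) (toPlane (e i)) ≤ 0 := by
  rw [toPlane_add, toPlane_zsmul, det₂_add_left, det₂_smul_left, R.det₂_height_succ, det₂_swap,
    R.det₂_dual]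
  have hd := R.dual_pos i
  have : 1 ≤ s * d i := one_le_mul_of_one_le_of_one_le hs hd
  have : (1 : ℝ) ≤ s * d i := by exact_mod_cast this
  linarith

lemma det₂_add_smul_edge_succ_nonpos (R : IsDualLoopPair q e L d) {i : Fin n} {s : ℤ}
    (hs : s + 1 ≤ L i) : det₂ (toPlane (q i + s • e i)) (toPlane (e (finRotate n i))) ≤ 0 := by
  have hq : q i + s • e i = q (finRotate n i) - (L i - s) • e i := by
    rw [R.move, sub_smul]
    abel
  rw [hq, toPlane_sub, toPlane_zsmul, det₂_sub_left, det₂_smul_left, R.det₂_height, R.det₂_dual]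
  have hd := R.dual_pos i
  have : 1 ≤ (L i - s) * d i := one_le_mul_of_one_le_of_one_le (by omega) hd
  have : (1 : ℝ) ≤ (L i - s : ℤ) * d i := by exact_mod_cast this
  linarith

end IsDualLoopPair

namespace IsEdgeData

lemma det₂_nonpos_of_succ_neg (D : IsEdgeData Γ p e l) {i j : Fin n}
    (hneg : det₂ (toPlane (e (finRotate n i))) (toPlane (e j)) < 0) :
    det₂ (toPlane (e i)) (toPlane (e j)) ≤ 0 :=
  not_lt.1 fun hpos ↦ (D.det₂_succ_nonneg_of_det₂_pos hpos).not_gt hneg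

/-- A vector pointing outwards over the single edge `i`, and not over its two neighbours, points
outwards over no other edge: otherwise the edges would not turn around the polygon only once. -/
lemma det₂_nonpos_of_ne (D : IsEdgeData Γ p e l) {i j : Fin n} {v : ℝ × ℝ}
    (hv : 0 ≤ det₂ v (toPlane (e (finRotate n i))))
    (hprev : det₂ v (toPlane (e i)) ≤ 0)
    (hnext : det₂ v (toPlane (e (finRotate n (finRotate n i)))) ≤ 0) (hji : j ≠ finRotate n i) :
    det₂ v (toPlane (e j)) ≤ 0 := by
  rcases lt_trichotomy (det₂ (toPlane (e (finRotate n i))) (toPlane (e j))) 0 with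
    hneg | hzero | hpos
  · have hprev_neg := D.det₂_nonpos_of_succ_neg hneg
    refine nonpos_of_mul_nonpos_right ?_ (D.turn i)
    rw [det₂_mul_det₂]
    linarith [mul_nonpos_of_nonneg_of_nonpos hv hprev_neg,
      mul_nonneg_of_nonpos_of_nonpos hprev hneg.le]
  · rw [det₂_toPlane, Int.cast_eq_zero] at hzero
    rcases eq_or_eq_neg_of_isCoprime (D.isCoprime _) (D.isCoprime _) hzero with heq | heq
    · exact absurd (D.edge_injective heq) hji
    · rw [heq, toPlane_neg, ← neg_one_smul ℝ, det₂_smul_right]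
      linarith
  · have hnext_pos := D.det₂_succ_nonneg_of_det₂_pos hpos
    refine nonpos_of_mul_nonpos_right ?_ (D.turn (finRotate n i))
    rw [det₂_mul_det₂]
    linarith [mul_nonpos_of_nonpos_of_nonneg hnext hpos.le, mul_nonneg hv hnext_pos]

lemma det₂_add_smul_nonpos (D : IsEdgeData Γ p e l) (R : IsDualLoopPair q e L d) {i j : Fin n}
    (hji : j ≠ i) {s : ℤ} (hs : 1 ≤ s) (hsL : s + 1 ≤ L i) :
    det₂ (toPlane (q i + s • e i)) (toPlane (e j)) ≤ 0 := by
  obtain ⟨i, rfl⟩ := (finRotate n).surjective i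
  exact D.det₂_nonpos_of_ne (R.det₂_add_smul s _ ▸ zero_le_one) (R.det₂_add_smul_succ_nonpos hs)
    (R.det₂_add_smul_edge_succ_nonpos hsL) hji

end IsEdgeData

lemma finite_toPlane_preimage {B : Set (ℝ × ℝ)} (hB : Bornology.IsBounded B) :
    (toPlane ⁻¹' B).Finite := by
  obtain ⟨r, hr⟩ := hB.exists_norm_le
  refine (Set.finite_Icc ((-⌈r⌉, -⌈r⌉) : ℤ × ℤ) (⌈r⌉, ⌈r⌉)).subset fun z hz ↦ ?_
  have hceil (a : ℤ) (ha : |(a : ℝ)| ≤ r) : -⌈r⌉ ≤ a ∧ a ≤ ⌈r⌉ :=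
    abs_le.1 (by exact_mod_cast ha.trans (Int.le_ceil r))
  obtain ⟨hlow₁, hup₁⟩ := hceil z.1 ((norm_fst_le (toPlane z)).trans (hr _ hz))
  obtain ⟨hlow₂, hup₂⟩ := hceil z.2 ((norm_snd_le (toPlane z)).trans (hr _ hz))
  exact ⟨⟨hlow₁, hlow₂⟩, hup₁, hup₂⟩

lemma IsLatticePolytope.isBounded (hΔ : IsLatticePolytope Δ) : Bornology.IsBounded Δ := by
  obtain ⟨S, rfl⟩ := hΔ
  exact isBounded_convexHull.2 (S.finite_toSet.image _).isBounded

lemma IsFacetInequality.linForm_lt_of_mem_interior {a : ℤ × ℤ} {b : ℤ}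
    (h : IsFacetInequality K a b) {x : ℝ × ℝ} (hx : x ∈ interior K) : linForm a x < b := by
  obtain ⟨y, hy, hlt⟩ := exists_det₂_gt_of_mem_interior hx
    (toPlane_ne_zero_of_isCoprime (e := (-a.2, a.1)) h.1.symm.neg_left)
  rw [← linForm_eq_det₂, ← linForm_eq_det₂] at hlt
  exact hlt.trans_le (h.2.1 y hy)

/-- Adding a column vector to a fixed interior lattice point gives a lattice point of `Δ`. -/
lemma finite_columnVectors (hΔ : Bornology.IsBounded Δ) {z : ℤ × ℤ}
    (hz : toPlane z ∈ interior Δ) : {v : ℤ × ℤ | IsColumnVector Δ v}.Finite := by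
  refine ((finite_toPlane_preimage hΔ).image (· - z)).subset ?_
  rintro v ⟨-, τ, ⟨a, b, hab, rfl⟩, hv⟩
  have hzτ : toPlane z ∉ {x ∈ Δ | linForm a x = b} :=
    fun hmem ↦ (hab.linForm_lt_of_mem_interior hz).ne hmem.2
  exact ⟨v + z, hv z ⟨interior_subset hz, hzτ⟩, add_sub_cancel_right v z⟩

lemma IsParallelPolygon.isColumnVector (Q : IsParallelPolygon e K P k) (D : IsEdgeData Γ p e l)
    {i : Fin n} (hi : 0 < k i) {v : ℤ × ℤ} (hv : det₂ (toPlane v) (toPlane (e i)) = 1)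
    (hle : ∀ j ≠ i, det₂ (toPlane v) (toPlane (e j)) ≤ 0) : IsColumnVector K v := by
  obtain ⟨b, hb⟩ := Q.exists_int_det₂ i (e i)
  refine ⟨?_, {x ∈ K | linForm (conormal (e i)) x = b},
    ⟨_, b, Q.isFacetInequality D hi hb, rfl⟩, fun z ⟨hz, hzτ⟩ ↦ (Q.mem_iff _).2 fun j ↦ ?_⟩
  · rintro rfl
    simp [det₂, toPlane] at hv
  · have hzj := (Q.mem_iff _).1 hz j
    rw [toPlane_add, det₂_add_left]
    rcases eq_or_ne j i with rfl | hji
    · have hne : det₂ (toPlane z) (toPlane (e j)) ≠ b :=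
        fun heq ↦ hzτ ⟨hz, by rw [linForm_conormal, heq]⟩
      have hlt := (hzj.trans_eq hb).lt_of_ne hne
      rw [hv, hb]
      rw [det₂_toPlane] at hlt ⊢
      norm_cast at hlt ⊢
      omega
    · linarith [hle j hji]

/-- The lattice points strictly inside the moves of positive length of the loop `q`. -/
def movePoint {n : ℕ} (q e : Fin n → ℤ × ℤ) (L : Fin n → ℤ)
    (a : Σ i, Fin (L i - 1).toNat) : ℤ × ℤ :=
  q a.1 + (((a.2 : ℕ) : ℤ) + 1) • e a.1

namespace IsEdgeData

lemma det₂_movePoint_nonpos (D : IsEdgeData Γ p e l) (R : IsDualLoopPair q e L d)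
    (a : Σ i, Fin (L i - 1).toNat) {j : Fin n} (hj : j ≠ a.1) :
    det₂ (toPlane (movePoint q e L a)) (toPlane (e j)) ≤ 0 :=
  D.det₂_add_smul_nonpos R hj (by omega) (by have := a.2.isLt; omega)

lemma movePoint_injective (D : IsEdgeData Γ p e l) (R : IsDualLoopPair q e L d) :
    Function.Injective (movePoint q e L) := by
  intro a b hab
  have hedge : a.1 = b.1 := by
    by_contra hne
    have hle := D.det₂_movePoint_nonpos R b hne
    rw [← hab, movePoint, R.det₂_add_smul] at hle
    exact hle.not_gt one_pos
  obtain ⟨i, s⟩ := a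
  obtain ⟨j, t⟩ := b
  obtain rfl : i = j := hedge
  have hsmul := congrArg toPlane (add_left_cancel hab)
  rw [toPlane_zsmul, toPlane_zsmul] at hsmul
  have hst := Int.cast_injective (smul_left_injective ℝ (D.edge_ne_zero i) hsmul)
  simp only [add_left_inj, Nat.cast_inj] at hst
  rw [Fin.ext hst]

lemma isColumnVector_movePoint (hΔ : IsLatticePolytope Δ) (hmax : IsMaximalPolytope Δ)
    (D : IsEdgeData (interiorPolytope Δ) p e l) (R : IsDualLoopPair q e L d)
    (a : Σ i, Fin (L i - 1).toNat) : IsColumnVector Δ (movePoint q e L a) := by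
  refine (isParallelPolygon_of_isMaximal hΔ hmax D R).isColumnVector D ?_ (R.det₂_add_smul _ a.1)
    fun j hj ↦ D.det₂_movePoint_nonpos R a hj
  have hl := D.length_pos a.1
  have hs := a.2.isLt
  omega

theorem sum_le_columnCount (hΔ : IsLatticePolytope Δ) (hmax : IsMaximalPolytope Δ)
    (D : IsEdgeData (interiorPolytope Δ) p e l) (R : IsDualLoopPair q e L d) :
    ∑ i, max 0 (L i - 1) ≤ (columnCount Δ : ℤ) := by
  obtain ⟨z, hz⟩ := D.lattice ⟨0, D.pos⟩
  have hfinite := finite_columnVectors hΔ.isBounded (z := z)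
    (hz ▸ interiorPolytope_subset_interior hΔ.convex (D.vertex_mem _))
  calc ∑ i, max 0 (L i - 1) = (Nat.card (Σ i, Fin (L i - 1).toNat) : ℤ) := by
        simp only [Nat.card_eq_fintype_card, Fintype.card_sigma, Fintype.card_fin, Nat.cast_sum,
          Int.toNat_eq_max, max_comm]
    _ = ((Set.range (movePoint q e L)).ncard : ℤ) := by
        rw [← Set.image_univ, Set.ncard_image_of_injective _ (D.movePoint_injective R),
          Set.ncard_univ]
    _ ≤ columnCount Δ := by
        exact_mod_cast Set.ncard_le_ncard
          (Set.range_subset_iff.2 (isColumnVector_movePoint hΔ hmax D R)) hfinite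

end IsEdgeData

end ColumnVectors

section LegalLoops

lemma det₂_eq_zero_of_collinear {a b c : ℝ × ℝ} (h : Collinear ℝ {a, b, c}) :
    det₂ (b - a) (c - b) = 0 := by
  obtain ⟨v, hv⟩ := (collinear_iff_of_mem (p₀ := a) (Set.mem_insert _ _)).1 h
  obtain ⟨s, rfl⟩ := hv b (by simp)
  obtain ⟨t, rfl⟩ := hv c (by simp)
  rw [vadd_eq_add, vadd_eq_add, add_sub_cancel_right, add_sub_add_right_eq_sub, ← sub_smul,
    det₂_smul_left, det₂_smul_right, det₂_self, mul_zero, mul_zero]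

lemma exists_smul_of_mem_convexHull_zero_pair {v w z : ℝ × ℝ}
    (hz : z ∈ convexHull ℝ {0, v, w}) :
    ∃ t ∈ Set.Icc (0 : ℝ) 1, ∃ y ∈ segment ℝ v w, z = t • y := by
  rw [convexHull_insert ⟨v, Set.mem_insert _ _⟩, convexHull_pair, mem_convexJoin] at hz
  obtain ⟨_, rfl, y, hy, a, t, ha, ht, hat, rfl⟩ := hz
  exact ⟨t, ⟨ht, by linarith⟩, y, hy, by rw [smul_zero, zero_add]⟩

lemma det₂_eq_of_mem_segment {v w y g : ℝ × ℝ} {c : ℝ} (hv : det₂ v g = c) (hw : det₂ w g = c)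
    (hy : y ∈ segment ℝ v w) : det₂ y g = c := by
  obtain ⟨a, b, -, -, hab, rfl⟩ := hy
  rw [det₂_add_left, det₂_smul_left, det₂_smul_left, hv, hw, ← add_mul, hab, one_mul]

/-- The triangle has no lattice points strictly between the heights zero and one. -/
lemma isLegalMove_of_det₂_eq_one {v w e : ℤ × ℤ} (hvw : v ≠ w)
    (hv : det₂ (toPlane v) (toPlane e) = 1) (hw : det₂ (toPlane w) (toPlane e) = 1) :
    IsLegalMove (toPlane v) (toPlane w) := by
  refine ⟨⟨v, rfl⟩, ⟨w, rfl⟩, fun hcol ↦ hvw ?_, fun z hz₀ hz ↦ ?_⟩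
  · have hdet := det₂_eq_zero_of_collinear hcol
    rw [sub_zero, det₂_sub_right, det₂_self, sub_zero] at hdet
    have hsmul := det₂_smul_eq (toPlane v) (toPlane w) (toPlane e)
    rw [hdet, zero_smul, det₂_swap, hw, hv, neg_one_smul, one_smul, eq_comm,
      neg_add_eq_zero] at hsmul
    exact toPlane_injective hsmul
  · obtain ⟨t, ⟨ht₀, ht₁⟩, y, hy, hzy⟩ := exists_smul_of_mem_convexHull_zero_pair hz
    have ht : det₂ (toPlane z) (toPlane e) = t := by
      rw [hzy, det₂_smul_left, det₂_eq_of_mem_segment hv hw hy, mul_one]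
    rw [det₂_toPlane] at ht
    obtain ⟨k, rfl⟩ : ∃ k : ℤ, (k : ℝ) = t := ⟨_, ht⟩
    have hk₀ : 0 ≤ k := Int.cast_nonneg_iff.1 ht₀
    have hk₁ : k ≤ 1 := by exact_mod_cast ht₁
    obtain rfl | rfl : k = 0 ∨ k = 1 := by omega
    · rw [Int.cast_zero, zero_smul, ← toPlane_zero] at hzy
      exact absurd (toPlane_injective hzy) hz₀
    · rwa [hzy, Int.cast_one, one_smul]

namespace IsDualLoopPair

variable {n : ℕ} {q e : Fin n → ℤ × ℤ} {L d : Fin n → ℤ}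

lemma det₂_succ (R : IsDualLoopPair q e L d) (i : Fin n) :
    det₂ (toPlane (q i)) (toPlane (q (finRotate n i))) = L i := by
  rw [R.move, toPlane_add, toPlane_zsmul, det₂_add_right, det₂_smul_right, det₂_self,
    R.det₂_height, zero_add, mul_one]

lemma eq_succ_iff (R : IsDualLoopPair q e L d) (i : Fin n) :
    q i = q (finRotate n i) ↔ L i = 0 := by
  refine ⟨fun h ↦ ?_, fun h ↦ by rw [R.move, h, zero_smul, add_zero]⟩
  have hdet := R.det₂_succ i
  rw [← h, det₂_self] at hdet
  exact_mod_cast hdet.symm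

lemma toPlane_succ_sub (R : IsDualLoopPair q e L d) (i : Fin n) :
    toPlane (q (finRotate n i)) - toPlane (q i) = (L i : ℝ) • toPlane (e i) := by
  rw [R.move, toPlane_add, toPlane_zsmul, add_sub_cancel_left]

lemma loopLength_eq (R : IsDualLoopPair q e L d) :
    loopLength (toPlane ∘ q) = (∑ i, L i : ℤ) := by
  simp only [loopLength, Function.comp_apply, R.det₂_succ, Int.cast_sum]

lemma dualLoop_eq (R : IsDualLoopPair q e L d) (hL : ∀ i, L i ≠ 0) :
    dualLoop (toPlane ∘ q) = toPlane ∘ e := by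
  funext i
  simp only [dualLoop, Function.comp_apply, R.det₂_succ, R.toPlane_succ_sub]
  exact inv_smul_smul₀ (Int.cast_ne_zero.2 (hL i)) _

lemma loopLength_dual_eq (R : IsDualLoopPair q e L d) :
    loopLength (toPlane ∘ e) = (∑ i, d i : ℤ) := by
  simp only [loopLength, Function.comp_apply, R.det₂_dual, Int.cast_sum]

lemma det₂_succ_sub_succ_sub_ne_zero (R : IsDualLoopPair q e L d) (hL : ∀ i, L i ≠ 0)
    (i : Fin n) :
    det₂ (toPlane (q (finRotate n i)) - toPlane (q i))
      (toPlane (q (finRotate n (finRotate n i))) - toPlane (q (finRotate n i))) ≠ 0 := by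
  rw [R.toPlane_succ_sub, R.toPlane_succ_sub, det₂_smul_left, det₂_smul_right, R.det₂_dual]
  have hd := (R.dual_pos i).ne'
  exact_mod_cast mul_ne_zero (hL i) (mul_ne_zero (hL _) hd)

theorem isLegalLoop (R : IsDualLoopPair q e L d) (hL : ∀ i, L i ≠ 0) :
    IsLegalLoop (toPlane ∘ q) :=
  ⟨fun i ↦ isLegalMove_of_det₂_eq_one ((R.eq_succ_iff i).not.2 (hL i)) (R.det₂_height i)
    (R.det₂_height_succ i),
    fun i hcol ↦ R.det₂_succ_sub_succ_sub_ne_zero hL i (det₂_eq_zero_of_collinear hcol)⟩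

lemma three_le (R : IsDualLoopPair q e L d) (hL : ∀ i, L i ≠ 0) (hn : 0 < n) : 3 ≤ n := by
  by_contra! hlt
  have hreturn : finRotate n (finRotate n ⟨0, hn⟩) = ⟨0, hn⟩ := by
    interval_cases n <;> rfl
  apply R.det₂_succ_sub_succ_sub_ne_zero hL ⟨0, hn⟩
  rw [hreturn, ← neg_sub, ← neg_one_smul ℝ, det₂_smul_left, det₂_self, mul_zero]

lemma card_le_sum (R : IsDualLoopPair q e L d) : (n : ℤ) ≤ ∑ i, d i := by
  simpa using Finset.card_nsmul_le_sum Finset.univ d 1 fun i _ ↦ R.dual_pos i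

end IsDualLoopPair

end LegalLoops

section OmittedRepetitions

variable {m n : ℕ} {k : Fin m → Fin n} {r : Fin n → Fin m} {q e : Fin n → ℤ × ℤ}
  {L d : Fin n → ℤ}

lemma comp_eq_of_forall_finRotate_eq {α : Type*} {f : Fin n → α} (hm : 0 < m)
    (hr : ∀ j, r (k j) = j) (hr_succ : ∀ i ∉ Set.range k, r i = r (finRotate n i))
    (hf : ∀ i ∉ Set.range k, f (finRotate n i) = f i) (i : Fin n) : f (k (r i)) = f i := by
  refine finRotate_backward_induction (I := Set.range k) (P := fun i ↦ f (k (r i)) = f i)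
    ⟨_, ⟨0, hm⟩, rfl⟩ ?_ (fun i hi hsucc ↦ ?_) i
  · rintro _ ⟨j, rfl⟩
    rw [hr]
  · rw [hr_succ i hi, hsucc, hf i hi]

namespace IsDualLoopPair

lemma det_dual (R : IsDualLoopPair q e L d) (i : Fin n) :
    (e i).1 * (e (finRotate n i)).2 - (e i).2 * (e (finRotate n i)).1 = d i := by
  have hdet := R.det₂_dual i
  rw [det₂_toPlane] at hdet
  exact_mod_cast hdet

/-- While the loop `q` stands still, the dual loop moves along the line through `e i` directed
by `q i`; `D i` is the distance left to the next index in the range of `k`. -/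
lemma exists_dual_distance (R : IsDualLoopPair q e L d) (hm : 0 < m)
    (hL : ∀ i ∉ Set.range k, L i = 0) (hr : ∀ j, r (k j) = j)
    (hr_succ : ∀ i ∉ Set.range k, r i = r (finRotate n i)) :
    ∃ D : Fin n → ℤ, (∀ i, e (k (r i)) = e i - D i • q i) ∧ (∀ i, 0 ≤ D i) ∧
      (∀ j, D (k j) = 0) ∧ ∀ i ∉ Set.range k, D i = d i + D (finRotate n i) := by
  have hq := comp_eq_of_forall_finRotate_eq hm hr hr_succ
    fun i hi ↦ ((R.eq_succ_iff i).2 (hL i hi)).symm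
  let D (i : Fin n) : ℤ := (e i).1 * (e (k (r i))).2 - (e i).2 * (e (k (r i))).1
  have hD (i : Fin n) : e (k (r i)) = e i - D i • q i :=
    eq_sub_smul_of_det_eq_one (R.height i) (hq i ▸ R.height _)
  have hD_mem (j : Fin m) : D (k j) = 0 := by
    simp only [D, hr]
    ring
  have hD_notMem (i : Fin n) (hi : i ∉ Set.range k) : D i = d i + D (finRotate n i) := by
    have hheight := R.height i
    rw [(R.eq_succ_iff i).2 (hL i hi)] at hheight
    change (e i).1 * (e (k (r i))).2 - (e i).2 * (e (k (r i))).1 = d i + D (finRotate n i)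
    rw [hr_succ i hi, hD (finRotate n i)]
    simp only [Prod.fst_sub, Prod.snd_sub, Prod.smul_fst, Prod.smul_snd, smul_eq_mul]
    linear_combination R.det_dual i + D (finRotate n i) * hheight
  refine ⟨D, hD, ?_, hD_mem, hD_notMem⟩
  refine finRotate_backward_induction (I := Set.range k) ⟨_, ⟨0, hm⟩, rfl⟩ ?_ fun i hi hsucc ↦ ?_
  · rintro _ ⟨j, rfl⟩
    exact (hD_mem j).ge
  · rw [hD_notMem i hi]
    exact add_nonneg (R.dual_pos i).le hsucc

theorem exists_isDualLoopPair_comp (R : IsDualLoopPair q e L d) (hk : StrictMono k) (hm : 0 < m)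
    (hL : ∀ i ∉ Set.range k, L i = 0) :
    ∃ X, IsDualLoopPair (q ∘ k) (e ∘ k) (L ∘ k) X ∧ ∑ j, X j = ∑ i, d i := by
  obtain ⟨r, hr, hr_succ, hr_next⟩ := exists_cyclic_ceil hk hm
  have hq := comp_eq_of_forall_finRotate_eq hm hr hr_succ
    fun i hi ↦ ((R.eq_succ_iff i).2 (hL i hi)).symm
  obtain ⟨D, hD, hD_nonneg, hD_mem, hD_notMem⟩ := R.exists_dual_distance hm hL hr hr_succ
  have hq_next (j : Fin m) : q (k (finRotate m j)) = q (finRotate n (k j)) := by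
    rw [← hr_next, hq]
  refine ⟨fun j ↦ d (k j) + D (finRotate n (k j)), ⟨fun j ↦ R.height _, fun j ↦ ?_, fun j ↦ ?_,
    fun j ↦ add_pos_of_pos_of_nonneg (R.dual_pos _) (hD_nonneg _)⟩, ?_⟩
  · exact (hq_next j).trans (R.move _)
  · simp only [Function.comp_apply, hq_next]
    rw [← hr_next, hD, R.dual_move, add_smul, sub_sub]
  · calc ∑ j, (d (k j) + D (finRotate n (k j))) = ∑ i, (d i + D (finRotate n i) - D i) :=
          Fintype.sum_of_injective k hk.injective _ _
            (fun i hi ↦ by rw [hD_notMem i hi, sub_self]) (fun j ↦ by rw [hD_mem, sub_zero])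
      _ = ∑ i, d i := by
          rw [Finset.sum_sub_distrib, Finset.sum_add_distrib, Equiv.sum_comp (finRotate n) D,
            add_sub_cancel_right]

end IsDualLoopPair

end OmittedRepetitions

section AssociatedLoops

variable {Γ Δ : Set (ℝ × ℝ)} {n : ℕ} {p : Fin n → ℝ × ℝ} {q e : Fin n → ℤ × ℤ}
  {l L d : Fin n → ℤ}

lemma IsLatticePolytope.finite_interiorLatticePoints (hΔ : IsLatticePolytope Δ) :
    (interiorLatticePoints Δ).Finite :=
  (finite_toPlane_preimage hΔ.isBounded).subset (Set.preimage_mono interior_subset)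

namespace IsEdgeData

lemma isRelaxedVertex_iff_eq_add (D : IsEdgeData Γ p e l) (R : IsDualLoopPair q e L d)
    (i : Fin n) (x : ℝ × ℝ) : IsRelaxedVertex Γ (p i) x ↔ x = p i + toPlane (q i) := by
  obtain ⟨i, rfl⟩ := (finRotate n).surjective i
  rw [D.isRelaxedVertex_iff, ← sub_eq_iff_eq_add']
  refine ⟨fun ⟨hprev, hnext⟩ ↦ sub_eq_zero.1 ?_, fun h ↦ ?_⟩
  · refine eq_zero_of_det₂_eq_zero (D.turn i).ne' ?_ ?_
    · rw [det₂_sub_left, hprev, R.det₂_height_succ, sub_self]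
    · rw [det₂_sub_left, hnext, R.det₂_height, sub_self]
  · rw [h]
    exact ⟨R.det₂_height_succ i, R.det₂_height _⟩

/-- Otherwise `q` is a constant vector of height one over all edges, but the edges add up to
zero. -/
lemma exists_move_length_ne_zero (D : IsEdgeData Γ p e l) (R : IsDualLoopPair q e L d) :
    ∃ i, L i ≠ 0 := by
  by_contra! hL
  have hconst := finRotate_induction (P := fun i ↦ q i = q ⟨0, D.pos⟩)
    (fun i hi ↦ ((R.eq_succ_iff i).2 (hL i)).symm.trans hi) rfl
  have hsum := D.sum_mul_det₂_eq_zero (toPlane (q ⟨0, D.pos⟩))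
  have hheight (i : Fin n) : det₂ (toPlane (q ⟨0, D.pos⟩)) (toPlane (e i)) = 1 :=
    hconst i ▸ R.det₂_height i
  simp only [hheight, mul_one] at hsum
  exact (Finset.sum_pos (fun i _ ↦ D.cast_length_pos i) ⟨⟨0, D.pos⟩, Finset.mem_univ _⟩).ne' hsum

end IsEdgeData

lemma exists_isEdgeData_isDualLoopPair (hΔ : IsLatticePolytope Δ) (hnh : IsNonhyperelliptic Δ)
    (hp : IsCounterclockwiseEnum (interiorPolytope Δ) p) :
    ∃ e l q L d, IsEdgeData (interiorPolytope Δ) p e l ∧ IsDualLoopPair q e L d := by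
  obtain ⟨e, l, D⟩ := hp.exists_isEdgeData (hΔ.finite_interiorLatticePoints.image toPlane)
    (Set.image_subset_range _ _) hnh
  obtain ⟨q, L, d, R⟩ := D.exists_isDualLoopPair hΔ
  exact ⟨e, l, q, L, d, D, R⟩

theorem exists_isAssociatedLoop (hΔ : IsLatticePolytope Δ) (hnh : IsNonhyperelliptic Δ) :
    ∃ (m : ℕ) (v : Fin m → ℝ × ℝ), IsAssociatedLoop Δ v := by
  obtain ⟨n, p, hp⟩ := exists_isCounterclockwiseEnum
    (hΔ.finite_interiorLatticePoints.image toPlane) hnh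
  obtain ⟨e, l, q, L, d, D, R⟩ := exists_isEdgeData_isDualLoopPair hΔ hnh hp
  obtain ⟨m, k, hk, hrange⟩ := exists_strictMono_range_eq
    {i | p i + toPlane (q i) - p i
      ≠ p (finRotate n i) + toPlane (q (finRotate n i)) - p (finRotate n i)}
  exact ⟨m, _, n, p, fun i ↦ p i + toPlane (q i), hp,
    fun i ↦ (D.isRelaxedVertex_iff_eq_add R i _).2 rfl, k, hk, hrange, rfl⟩

theorem IsAssociatedLoop.exists_isDualLoopPair {m : ℕ} {v : Fin m → ℝ × ℝ}
    (hv : IsAssociatedLoop Δ v) (hΔ : IsLatticePolytope Δ) (hmax : IsMaximalPolytope Δ)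
    (hnh : IsNonhyperelliptic Δ) :
    ∃ (q e : Fin m → ℤ × ℤ) (L d : Fin m → ℤ), v = toPlane ∘ q ∧ IsDualLoopPair q e L d ∧
      0 < m ∧ (∀ j, L j ≠ 0) ∧ ∑ j, L j + ∑ j, d j = 12 ∧
      (boundaryCount Δ : ℤ) - boundaryCount (interiorPolytope Δ) = ∑ j, L j ∧
      ∑ j, L j - m ≤ (columnCount Δ : ℤ) := by
  obtain ⟨n, p, p', hp, hp', k, hk, hrange, rfl⟩ := hv
  obtain ⟨e, l, q, L, d, D, R⟩ := exists_isEdgeData_isDualLoopPair hΔ hnh hp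
  have hq (i : Fin n) : p' i - p i = toPlane (q i) :=
    sub_eq_iff_eq_add'.2 ((D.isRelaxedVertex_iff_eq_add R i _).1 (hp' i))
  simp only [hq, toPlane_injective.ne_iff] at hrange ⊢
  have hmem (i : Fin n) : i ∈ Set.range k ↔ L i ≠ 0 := by
    rw [hrange]
    exact (R.eq_succ_iff i).not
  have hL (i : Fin n) (hi : i ∉ Set.range k) : L i = 0 := not_not.1 ((hmem i).not.1 hi)
  have hm : 0 < m := by
    obtain ⟨i, hi⟩ := D.exists_move_length_ne_zero R
    obtain ⟨j, -⟩ := (hmem i).2 hi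
    exact j.pos
  obtain ⟨X, RX, hX⟩ := R.exists_isDualLoopPair_comp hk hm hL
  have hsum : ∑ j, L (k j) = ∑ i, L i :=
    Fintype.sum_of_injective k hk.injective _ _ hL fun j ↦ rfl
  refine ⟨q ∘ k, e ∘ k, L ∘ k, X, rfl, RX, hm, fun j ↦ (hmem _).1 ⟨j, rfl⟩, ?_, ?_, ?_⟩ <;>
    simp only [Function.comp_apply]
  · rw [hX, hsum, D.sum_add_sum_eq_twelve R]
  · rw [hsum, D.boundaryCount_sub_eq_sum hΔ hmax R]
  · calc ∑ j, L (k j) - m = ∑ j, (L (k j) - 1) := by simp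
      _ ≤ ∑ j, max 0 (L (k j) - 1) := Finset.sum_le_sum fun j _ ↦ le_max_right _ _
      _ = ∑ i, max 0 (L i - 1) := Fintype.sum_of_injective k hk.injective _ _
          (fun i hi ↦ by rw [hL i hi]; rfl) fun j ↦ rfl
      _ ≤ columnCount Δ := D.sum_le_columnCount hΔ hmax R

end AssociatedLoops

theorem mainTheorem5 (Δ : Set (ℝ × ℝ)) (hΔ : IsLatticePolytope Δ)
    (hmax : IsMaximalPolytope Δ) (hnh : IsNonhyperelliptic Δ) :
    (∃ (n : ℕ) (v : Fin n → ℝ × ℝ), IsAssociatedLoop Δ v) ∧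
    ∀ (n : ℕ) (v : Fin n → ℝ × ℝ), IsAssociatedLoop Δ v →
      IsLegalLoop v ∧
      ((boundaryCount Δ : ℝ) - (boundaryCount (interiorPolytope Δ) : ℝ) = loopLength v ∧
        loopLength v ≤ 9) ∧
      ((boundaryCount Δ : ℝ) - (boundaryCount (interiorPolytope Δ) : ℝ) - (columnCount Δ : ℝ)
          ≤ min (loopLength v) (loopLength (dualLoop v)) ∧
        min (loopLength v) (loopLength (dualLoop v)) ≤ 6) := by
  refine ⟨exists_isAssociatedLoop hΔ hnh, fun m v hv ↦ ?_⟩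
  obtain ⟨q, e, L, d, rfl, R, hm, hL, htwelve, hboundary, hcolumn⟩ :=
    hv.exists_isDualLoopPair hΔ hmax hnh
  have hthree := R.three_le hL hm
  have hcard := R.card_le_sum
  have hnine : ∑ j, L j ≤ 9 := by omega
  have hmin : (boundaryCount Δ : ℤ) - boundaryCount (interiorPolytope Δ) - columnCount Δ
      ≤ min (∑ j, L j) (∑ j, d j) := by omega
  have hsix : min (∑ j, L j) (∑ j, d j) ≤ 6 := by omega
  rw [R.dualLoop_eq hL, R.loopLength_dual_eq, R.loopLength_eq]
  exact ⟨R.isLegalLoop hL, ⟨by exact_mod_cast hboundary, by exact_mod_cast hnine⟩,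
    by exact_mod_cast hmin, by exact_mod_cast hsix⟩
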